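/- Let $k$ be a commutative ring, $\mathfrak a$ a small $k$-linear category, $\mathcal C$ a $k$-linear Grothendieck abelian category and $u:\mathfrak a\to\mathcal C$ a $k$-linear functor. Let $\mathsf{Mod}(\mathfrak a)$ be the category of $k$-linear functors $\mathfrak a^{\mathrm{op}}\to\mathsf{Mod}(k)$, and let $$i:\mathcal C\to\mathsf{Mod}(\mathfrak a),\qquad X\mapsto\mathcal C(u(-),X).$$ A covering system $\mathcal T$ on $\mathfrak a$ assigns to every object $A$ a collection $\mathcal T(A)$ of subfunctors $R\subseteq\mathfrak a(-,A)$ in $\mathsf{Mod}(\mathfrak a)$, called coverings of $A$. It is a ($k$-linear) topology if (i) $\mathfrak a(-,A)\in\mathcal T(A)$ for every $A$; (ii) $f^{-1}R\in\mathcal T(B)$ for all $R\in\mathcal T(A)$ and $f:B\to A$, where $f^{-1}R=\{g : fg\in R\}$; (iii) if $S\in\mathcal T(A)$ and $R\subseteq\mathfrak a(-,A)$ is a subfunctor with $f^{-1}R\in\mathcal T(B)$ for every $f:B\to A$ in $S$, then $R\in\mathcal T(A)$. For a topology $\mathcal T$, $\mathsf{Sh}(\mathfrak a,\mathcal T)\subseteq\mathsf{Mod}(\mathfrak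 a)$ is the full subcategory of those $M$ such that, for every $A$ and every $R\in\mathcal T(A)$, each morphism $R\to M$ extends uniquely to a morphism $\mathfrak a(-,A)\to M$. A morphism $f:M\to N$ in $\mathsf{Mod}(\mathfrak a)$ is a $\mathcal T$-epimorphism if for every $y\in N(A)$ there is an $R\in\mathcal T(A)$ such that $N(g)(y)$ is in the image of $f_{B}$ for every $g:B\to A$ in $R$; it is a $\mathcal T$-monomorphism if for every $x\in M(A)$ with $f_A(x)=0$ there is an $R\in\mathcal T(A)$ such that $M(g)(x)=0$ for every $g:B\to A$ in $R$. The functor $u$ is called - generating, if the objects $u(A)$, $A\in\mathfrak a$, form a collection of generators of $\mathcal C$; - $\mathcal T$-full (resp. $\mathcal T$-faithful), if for every $A$ the canonical morphism $\mathfrak a(-,A)\to\mathcal C(u(-),u(A))$ is a $\mathcal T$-epimorphism (resp. a $\mathcal T$-monomorphism); - $\mathcal T$-projective, if $i(c)$ is a $\mathcal T$-epimorphism for every epimorphism $c$ of $\mathcal C$; - $\mathcal T$-finitely presented, if for every small filtered diagram $(X_j)_j$ in $\mathcal C$ the canonical morphism $\mathrm{colim}_j\,\mathcal C(u(-),X_j)\to\mathcal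 C(u(-),\mathrm{colim}_jX_j)$ is both a $\mathcal T$-epimorphism and a $\mathcal T$-monomorphism; - $\mathcal T$-ample, if for every $A$ and every $R\in\mathcal T(A)$ the canonical morphism $\bigoplus_{f\in R(A_f)}u(A_f)\to u(A)$, the sum being over all $f:A_f\to A$ in $R$, is an epimorphism in $\mathcal C$. Finally, $u$ induces a localization if $i$ is fully faithful and has an exact left adjoint $a:\mathsf{Mod}(\mathfrak a)\to\mathcal C$. **Theorem.** Let $\mathcal T$ be a topology on $\mathfrak a$. The following are equivalent: 1. $u$ induces a localization, and $i$ factors (up to natural isomorphism) through an equivalence $\mathcal C\simeq\mathsf{Sh}(\mathfrak a,\mathcal T)$ followed by the inclusion $\mathsf{Sh}(\mathfrak a,\mathcal T)\subseteq\mathsf{Mod}(\mathfrak a)$. 2. $u$ is generating, $\mathcal T$-full, $\mathcal T$-faithful, $\mathcal T$-projective, $\mathcal T$-finitely presented and $\mathcal T$-ample. -/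

import Mathlib

open CategoryTheory CategoryTheory.Limits Opposite

universe w v u

noncomputable section

namespace LinTop

/-! ### Modules over a linear category -/

section Modules

variable (k : Type w) [CommRing k] (𝔞 : Type v) [SmallCategory 𝔞] [Preadditive 𝔞] [Linear k 𝔞]

/-- The property of a presheaf of `k`-modules on `𝔞` of being a `k`-linear functor. -/
structure IsLinearPresheaf (M : 𝔞ᵒᵖ ⥤ ModuleCat.{v} k) : Prop where
  map_add : ∀ {A B : 𝔞} (f g : B ⟶ A), M.map (f + g).op = M.map f.op + M.map g.op
  map_smul : ∀ {A B : 𝔞} (r : k) (f : B ⟶ A), M.map (r • f).op = r • M.map f.op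

/-- The category `Mod(𝔞)` of right `𝔞`-modules: `k`-linear functors `𝔞ᵒᵖ ⥤ Mod(k)`, with all
natural transformations between them. -/
abbrev RMod : Type (max (v + 1) w) :=
  ObjectProperty.FullSubcategory (C := 𝔞ᵒᵖ ⥤ ModuleCat.{v} k) (fun M => IsLinearPresheaf k 𝔞 M)

end Modules

variable {k : Type w} [CommRing k] {𝔞 : Type v} [SmallCategory 𝔞] [Preadditive 𝔞] [Linear k 𝔞]

variable (k) in
/-- The representable module `𝔞(-, A)`. -/
def rep (A : 𝔞) : RMod k 𝔞 where
  obj := (linearYoneda k 𝔞).obj A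
  property :=
    { map_add := fun f g => by
        ext x
        exact Preadditive.add_comp _ _ _ f g x
      map_smul := fun r f => by
        ext x
        exact Linear.smul_comp _ _ _ r f x }

/-! ### Linear sieves, covering systems and linear topologies -/

variable (k) in
/-- A subfunctor (submodule) `R` of the representable module `𝔞(-, A)`. -/
@[ext]
structure LinearSieve (A : 𝔞) where
  arrows : ∀ B : 𝔞, Submodule k (B ⟶ A)
  downward_closed : ∀ {B D : 𝔞} {f : B ⟶ A}, f ∈ arrows B → ∀ g : D ⟶ B, g ≫ f ∈ arrows D

namespace LinearSieve

variable (k) in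
/-- The maximal subfunctor `𝔞(-, A)` of itself. -/
def top (A : 𝔞) : LinearSieve k A where
  arrows _ := ⊤
  downward_closed _ _ := trivial

/-- The pullback `f⁻¹R` of `R ⊆ 𝔞(-, A)` along `f : B ⟶ A`. -/
def pullback {A B : 𝔞} (R : LinearSieve k A) (f : B ⟶ A) : LinearSieve k B where
  arrows D := (R.arrows D).comap (Linear.rightComp k D f)
  downward_closed {D E h} hh g := by
    change (g ≫ h) ≫ f ∈ R.arrows E
    rw [Category.assoc]
    exact R.downward_closed hh g

/-- A subfunctor of `𝔞(-, A)`, viewed as a module. -/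
def toMod {A : 𝔞} (R : LinearSieve k A) : RMod k 𝔞 where
  obj :=
    { obj := fun B => ModuleCat.of k (R.arrows B.unop)
      map := fun {B D} g => ModuleCat.ofHom
        ((Linear.leftComp k A g.unop).restrict fun _ hf => R.downward_closed hf g.unop)
      map_id := fun B => by
        refine ModuleCat.hom_ext (LinearMap.ext fun x => Subtype.ext ?_)
        exact (Category.id_comp x.1)
      map_comp := fun g h => by
        refine ModuleCat.hom_ext (LinearMap.ext fun x => Subtype.ext ?_)
        exact (Category.assoc h.unop g.unop x.1) }
  property :=
    { map_add := fun f g => by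
        refine ModuleCat.hom_ext (LinearMap.ext fun x => Subtype.ext ?_)
        exact (Preadditive.add_comp _ _ _ f g x.1)
      map_smul := fun r f => by
        refine ModuleCat.hom_ext (LinearMap.ext fun x => Subtype.ext ?_)
        exact (Linear.smul_comp _ _ _ r f x.1) }

/-- The inclusion `R ⟶ 𝔞(-, A)`. -/
def incl {A : 𝔞} (R : LinearSieve k A) : R.toMod ⟶ rep k A :=
  ObjectProperty.homMk
    { app := fun B => ModuleCat.ofHom (R.arrows B.unop).subtype
      naturality := fun _ _ _ => rfl }

end LinearSieve

variable (k 𝔞) in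
/-- A covering system: for every object `A`, a collection of subfunctors of `𝔞(-, A)`. -/
def CoveringSystem : Type v := ∀ A : 𝔞, Set (LinearSieve k A)

namespace CoveringSystem

variable (T : CoveringSystem k 𝔞)

/-- A covering system is a linear topology if it satisfies the linearized axioms of a
Grothendieck topology: identity, pullback, glueing. -/
structure IsTopology : Prop where
  top_mem : ∀ A : 𝔞, LinearSieve.top k A ∈ T A
  pullback_mem : ∀ {A B : 𝔞} (R : LinearSieve k A), R ∈ T A →
    ∀ f : B ⟶ A, R.pullback f ∈ T B
  glueing : ∀ {A : 𝔞} (S : LinearSieve k A), S ∈ T A → ∀ R : LinearSieve k A,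
    (∀ (B : 𝔞) (f : B ⟶ A), f ∈ S.arrows B → R.pullback f ∈ T B) → R ∈ T A

/-- `M` is a sheaf for `T` if, for every covering `R ⊆ 𝔞(-, A)`, every morphism `R ⟶ M` extends
uniquely to `𝔞(-, A)`. -/
def IsSheaf (M : RMod k 𝔞) : Prop :=
  ∀ (A : 𝔞) (R : LinearSieve k A), R ∈ T A →
    Function.Bijective (fun φ : rep k A ⟶ M => R.incl ≫ φ)

/-- The category `Sh(𝔞, T)` of linear sheaves, as a full subcategory of `Mod(𝔞)`. -/
abbrev Sh : Type (max (v + 1) w) :=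
  ObjectProperty.FullSubcategory (C := RMod k 𝔞) (fun M => T.IsSheaf M)

/-- The inclusion `Sh(𝔞, T) ⥤ Mod(𝔞)`. -/
abbrev shIncl : T.Sh ⥤ RMod k 𝔞 := ObjectProperty.ι (fun M => T.IsSheaf M)

/-- `T`-epimorphisms in `Mod(𝔞)`. -/
def IsEpi {M N : RMod k 𝔞} (f : M ⟶ N) : Prop :=
  ∀ (A : 𝔞) (y : N.obj.obj (op A)), ∃ R ∈ T A, ∀ (B : 𝔞) (g : B ⟶ A), g ∈ R.arrows B →
    ∃ x : M.obj.obj (op B), f.hom.app (op B) x = N.obj.map g.op y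

/-- `T`-monomorphisms in `Mod(𝔞)`. -/
def IsMono {M N : RMod k 𝔞} (f : M ⟶ N) : Prop :=
  ∀ (A : 𝔞) (x : M.obj.obj (op A)), f.hom.app (op A) x = 0 →
    ∃ R ∈ T A, ∀ (B : 𝔞) (g : B ⟶ A), g ∈ R.arrows B → M.obj.map g.op x = 0

end CoveringSystem

/-! ### Linear functors into a Grothendieck category -/

section Functors

variable {𝒞 : Type u} [Category.{v} 𝒞] [Abelian 𝒞] [Linear k 𝒞]
variable (k) (u : 𝔞 ⥤ 𝒞) [u.Additive] [u.Linear k]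

/-- The module `𝒞(u(-), X)`. -/
def homMod (X : 𝒞) : RMod k 𝔞 where
  obj := u.op ⋙ (linearYoneda k 𝒞).obj X
  property :=
    { map_add := fun f g => by
        refine ModuleCat.hom_ext (LinearMap.ext fun (x : u.obj _ ⟶ X) => ?_)
        change u.map (f + g) ≫ x = u.map f ≫ x + u.map g ≫ x
        rw [u.map_add, Preadditive.add_comp]
      map_smul := fun r f => by
        refine ModuleCat.hom_ext (LinearMap.ext fun (x : u.obj _ ⟶ X) => ?_)
        change u.map (r • f) ≫ x = r • (u.map f ≫ x)
        rw [u.map_smul, Linear.smul_comp] }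

/-- The functor `i : 𝒞 ⥤ Mod(𝔞)`, `X ↦ 𝒞(u(-), X)`. -/
def inducedFunctor : 𝒞 ⥤ RMod k 𝔞 where
  obj X := homMod k u X
  map c := ObjectProperty.homMk (Functor.whiskerLeft u.op ((linearYoneda k 𝒞).map c))
  map_id X := by
    apply ObjectProperty.hom_ext
    ext A x
    exact Category.comp_id (X := u.obj A.unop) x
  map_comp c d := by
    apply ObjectProperty.hom_ext
    ext A x
    exact (Category.assoc (W := u.obj A.unop) x c d).symm

/-- The canonical morphism `𝔞(-, A) ⟶ 𝒞(u(-), u(A))`, `f ↦ u(f)`. -/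
def repToHomMod (A : 𝔞) : rep k A ⟶ (inducedFunctor k u).obj (u.obj A) :=
  ObjectProperty.homMk
    { app := fun B => ModuleCat.ofHom (u.mapLinearMap k (X := B.unop) (Y := A))
      naturality := fun B D g => by
        ext x
        exact u.map_comp g.unop x }

/-- `u` induces a localization: `i` is fully faithful and has an exact left adjoint. -/
def InducesLocalization : Prop :=
  (inducedFunctor k u).Full ∧ (inducedFunctor k u).Faithful ∧
    ∃ (a : RMod k 𝔞 ⥤ 𝒞) (_ : a ⊣ inducedFunctor k u),
      PreservesFiniteLimits a ∧ PreservesFiniteColimits a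

variable {k} (T : CoveringSystem k 𝔞)

/-- `i` factors through an equivalence `𝒞 ≌ Sh(𝔞, T)`. -/
def FactorsThroughEquivSh : Prop :=
  ∃ e : 𝒞 ≌ T.Sh, Nonempty (e.functor ⋙ T.shIncl ≅ inducedFunctor k u)

/-- The objects `u(A)` form a collection of generators of `𝒞`. -/
def IsGenerating (u : 𝔞 ⥤ 𝒞) : Prop := (ObjectProperty.ofObj u.obj).IsSeparating

def IsTFull : Prop := ∀ A : 𝔞, T.IsEpi (repToHomMod k u A)

def IsTFaithful : Prop := ∀ A : 𝔞, T.IsMono (repToHomMod k u A)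

def IsTProjective : Prop :=
  ∀ ⦃X Y : 𝒞⦄ (c : X ⟶ Y), Epi c → T.IsEpi ((inducedFunctor k u).map c)

/-- For every small filtered diagram `F` in `𝒞`, the canonical morphism
`colim 𝒞(u(-), F j) ⟶ 𝒞(u(-), colim F)`, the first colimit taken in `Mod(𝔞)`, is a
`T`-epimorphism and a `T`-monomorphism. -/
def IsTFinitelyPresented : Prop :=
  ∀ (J : Type v) [SmallCategory J] [IsFiltered J] (F : J ⥤ 𝒞)
    (c : Cocone F) (_ : IsColimit c)
    (d : Cocone (F ⋙ inducedFunctor k u)) (hd : IsColimit d),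
    T.IsEpi (hd.desc ((inducedFunctor k u).mapCocone c)) ∧
      T.IsMono (hd.desc ((inducedFunctor k u).mapCocone c))

/-- For every covering `R` of `A`, the canonical morphism `⨁_{f ∈ R} u(A_f) ⟶ u(A)`, indexed by
all arrows `f : A_f ⟶ A` in `R`, is an epimorphism. -/
def IsTAmple [IsGrothendieckAbelian.{v} 𝒞] : Prop :=
  ∀ (A : 𝔞) (R : LinearSieve k A), R ∈ T A →
    Epi (Sigma.desc (f := fun p : (Σ B : 𝔞, R.arrows B) => u.obj p.1)
      fun p => u.map (p.2 : p.1 ⟶ A))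

end Functors

end LinTop

end

noncomputable section

namespace LinTop

variable {k : Type w} [CommRing k] {𝔞 : Type v} [SmallCategory 𝔞] [Preadditive 𝔞] [Linear k 𝔞]

/-! ### Sections, restriction maps and morphisms of modules -/

/-! Call a morphism of modules a `T`-isomorphism if it is both a `T`-epimorphism and a
`T`-monomorphism. Sheaves cannot see such morphisms: maps into a sheaf extend uniquely along them
(`exists_extension`, `hom_ext_of_isEpi`).

From 1 to 2: sheaves are, up to isomorphism, the modules `i X`, and there are enough of them to
detect local properties, because the closure of any subfunctor is the kernel of a morphism to a
sheaf (`exists_sheaf_ker_eq_closure`). Thus `f` is a `T`-epimorphism as soon as it can be cancelled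
before maps to all `i X`. If composition with `f` is even bijective on maps to all `i X`, then `a f`
is invertible, and left exactness of `a` forces the kernel of `f` to be locally zero. Each condition
then becomes a universal property in `𝒞`.

From 2 to 1: local fullness, faithfulness and finite presentation make `⨁ 𝔞(-, A j) ⟶ i (∐ u (A j))`
a `T`-isomorphism. With generators and ampleness, a morphism of `𝒞` can be prescribed on a jointly
epimorphic family subject only to the linear relations (`exists_desc`); hence `i` is full and each
`i X` is a sheaf. Carrying a free presentation of `M` over to `𝒞` and taking the cokernel `X` gives,
by projectivity, a `T`-isomorphism `M ⟶ i X` (`exists_isEpi_isMono`). It is the unit of an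
adjunction, and an isomorphism when `M` is a sheaf. The left adjoint is left exact because finite
limits can be compared locally, on finite intersections of coverings. -/

/-- The `k`-module of sections of `M` at `A`. -/
abbrev sec (M : RMod k 𝔞) (A : 𝔞) : Type v := M.obj.obj (op A)

/-- The restriction map `M(A) → M(B)` along `g : B ⟶ A`. -/
def res (M : RMod k 𝔞) {A B : 𝔞} (g : B ⟶ A) : sec M A →ₗ[k] sec M B := (M.obj.map g.op).hom

/-- The component at `A` of a morphism of modules. -/
def ev {M N : RMod k 𝔞} (f : M ⟶ N) (A : 𝔞) : sec M A →ₗ[k] sec N A := (f.hom.app (op A)).hom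

section Basics

variable {M N P : RMod k 𝔞} {A B D : 𝔞}

lemma res_id (x : sec M A) : res M (𝟙 A) x = x := by simp [res]

lemma res_res (g : B ⟶ A) (h : D ⟶ B) (x : sec M A) :
    res M h (res M g x) = res M (h ≫ g) x := by simp [res]

lemma res_add (f g : B ⟶ A) (x : sec M A) : res M (f + g) x = res M f x + res M g x := by
  exact congr(($(M.property.map_add f g)).hom x)

lemma res_smul (r : k) (g : B ⟶ A) (x : sec M A) : res M (r • g) x = r • res M g x := by
  exact congr(($(M.property.map_smul r g)).hom x)

lemma ev_res (f : M ⟶ N) (g : B ⟶ A) (x : sec M A) :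
    ev f B (res M g x) = res N g (ev f A x) :=
  congr($(f.hom.naturality g.op) x)

@[simp]
lemma ev_id (x : sec M A) : ev (𝟙 M) A x = x := rfl

@[simp]
lemma ev_comp (f : M ⟶ N) (g : N ⟶ P) (x : sec M A) : ev (f ≫ g) A x = ev g A (ev f A x) := rfl

lemma hom_ext_ev {f g : M ⟶ N} (h : ∀ A x, ev f A x = ev g A x) : f = g := by
  apply ObjectProperty.hom_ext
  ext A x
  exact h A.unop x

/-- Construct a morphism of modules from its components. -/
def mkHom (φ : ∀ A, sec M A →ₗ[k] sec N A)
    (h : ∀ {A B : 𝔞} (g : B ⟶ A) (x : sec M A), φ B (res M g x) = res N g (φ A x)) : M ⟶ N :=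
  ObjectProperty.homMk
    { app := fun A => ModuleCat.ofHom (φ A.unop)
      naturality := fun A B g => by
        ext x
        exact h g.unop x }

/-- Construct a module from its sections and restriction maps. -/
def mkMod (S : 𝔞 → Type v) [∀ A, AddCommGroup (S A)] [∀ A, Module k (S A)]
    (ρ : ∀ {A B : 𝔞} (_ : B ⟶ A), S A →ₗ[k] S B)
    (map_id : ∀ (A) (x : S A), ρ (𝟙 A) x = x)
    (map_comp : ∀ {A B D : 𝔞} (g : B ⟶ A) (h : D ⟶ B) (x : S A), ρ (h ≫ g) x = ρ h (ρ g x))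
    (map_add : ∀ {A B : 𝔞} (f g : B ⟶ A) (x : S A), ρ (f + g) x = ρ f x + ρ g x)
    (map_smul : ∀ {A B : 𝔞} (r : k) (g : B ⟶ A) (x : S A), ρ (r • g) x = r • ρ g x) :
    RMod k 𝔞 where
  obj :=
    { obj := fun A => ModuleCat.of k (S A.unop)
      map := fun g => ModuleCat.ofHom (ρ g.unop)
      map_id := fun A => ModuleCat.hom_ext (LinearMap.ext fun x => map_id A.unop x)
      map_comp := fun g h =>
        ModuleCat.hom_ext (LinearMap.ext fun x => map_comp g.unop h.unop x) }
  property :=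
    { map_add := fun f g => ModuleCat.hom_ext (LinearMap.ext fun x => map_add f g x)
      map_smul := fun r f => ModuleCat.hom_ext (LinearMap.ext fun x => map_smul r f x) }

lemma mono_of_ev_injective (f : M ⟶ N) (h : ∀ A, Function.Injective (ev f A)) : Mono f :=
  ⟨fun a b hab => hom_ext_ev fun A x => h A (by rw [← ev_comp, hab, ev_comp])⟩

/-! ### Submodules of a module -/

/-- The linear map `g ↦ M(g)(x)`. -/
def orbit (x : sec M A) (B : 𝔞) : (B ⟶ A) →ₗ[k] sec M B where
  toFun g := res M g x
  map_add' f g := res_add f g x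
  map_smul' r g := res_smul r g x

/-- The morphism `𝔞(-, A) ⟶ M` that corresponds to `x ∈ M(A)`. -/
def repHom (x : sec M A) : rep k A ⟶ M :=
  mkHom (fun B => orbit x B) fun g f => (res_res f g x).symm

/-- A morphism `g : B ⟶ A`, viewed as a section of `𝔞(-, A)`. -/
def repSec (g : B ⟶ A) : sec (rep k A) B := g

lemma res_repSec (g : B ⟶ A) (h : D ⟶ B) :
    res (rep k A) h (repSec g) = repSec (h ≫ g) := rfl

lemma repSec_surjective (x : sec (rep k A) B) : ∃ g : B ⟶ A, repSec g = x := ⟨x, rfl⟩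

@[simp]
lemma ev_repHom (x : sec M A) (g : B ⟶ A) : ev (repHom x) B (repSec g) = res M g x := rfl

lemma ev_repSec (φ : rep k A ⟶ M) (g : B ⟶ A) :
    ev φ B (repSec g) = res M g (ev φ A (repSec (𝟙 A))) := by
  rw [← ev_res, res_repSec, Category.comp_id]

lemma rep_hom_ext {φ ψ : rep k A ⟶ M}
    (h : ev φ A (repSec (𝟙 A)) = ev ψ A (repSec (𝟙 A))) : φ = ψ :=
  hom_ext_ev fun B g => by
    obtain ⟨g, rfl⟩ := repSec_surjective g
    exact (ev_repSec φ g).trans (h ▸ (ev_repSec ψ g).symm)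

end Basics

/-- A subfunctor of a module. -/
@[ext]
structure SubMod (M : RMod k 𝔞) where
  carrier : ∀ A : 𝔞, Submodule k (sec M A)
  res_mem : ∀ {A B : 𝔞} (g : B ⟶ A) {x : sec M A}, x ∈ carrier A → res M g x ∈ carrier B

namespace SubMod

variable {M N : RMod k 𝔞} {A B : 𝔞}

/-- The linear sieve of all `g` with `M(g)(x) ∈ U`. -/
def sieve (U : SubMod M) (x : sec M A) : LinearSieve k A where
  arrows B := (U.carrier B).comap (orbit x B)
  downward_closed {B D f} hf g := by
    change res M (g ≫ f) x ∈ U.carrier D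
    rw [← res_res]
    exact U.res_mem g hf

lemma mem_sieve (U : SubMod M) (x : sec M A) (g : B ⟶ A) :
    g ∈ (U.sieve x).arrows B ↔ res M g x ∈ U.carrier B := Iff.rfl

lemma pullback_sieve (U : SubMod M) (x : sec M A) (g : B ⟶ A) :
    (U.sieve x).pullback g = U.sieve (res M g x) := by
  ext D h
  change res M (h ≫ g) x ∈ U.carrier D ↔ res M h (res M g x) ∈ U.carrier D
  rw [res_res]

variable (M) in
/-- The zero subfunctor. -/
def zero : SubMod M where
  carrier _ := ⊥
  res_mem g x hx := by
    rw [Submodule.mem_bot] at hx ⊢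
    rw [hx, map_zero]

/-- The image of a morphism. -/
def range (f : M ⟶ N) : SubMod N where
  carrier A := LinearMap.range (ev f A)
  res_mem g _ := by
    rintro ⟨x, rfl⟩
    exact ⟨res M g x, ev_res f g x⟩

/-- The preimage of a subfunctor. -/
def comap (f : M ⟶ N) (U : SubMod N) : SubMod M where
  carrier A := (U.carrier A).comap (ev f A)
  res_mem g x hx := by
    rw [Submodule.mem_comap, ev_res]
    exact U.res_mem g hx

lemma sieve_comap (f : M ⟶ N) (U : SubMod N) (x : sec M A) :
    (U.comap f).sieve x = U.sieve (ev f A x) := by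
  ext B g
  change ev f B (res M g x) ∈ U.carrier B ↔ res N g (ev f A x) ∈ U.carrier B
  rw [ev_res]

/-- The kernel of a morphism. -/
def ker (f : M ⟶ N) : SubMod M := (zero N).comap f

/-- A subfunctor, viewed as a module. -/
def toMod (U : SubMod M) : RMod k 𝔞 :=
  mkMod (fun A => U.carrier A) (fun g => (res M g).restrict fun _ hx => U.res_mem g hx)
    (fun _ x => Subtype.ext (res_id x.1))
    (fun g h x => Subtype.ext (res_res g h x.1).symm)
    (fun f g x => Subtype.ext (res_add f g x.1))
    (fun r g x => Subtype.ext (res_smul r g x.1))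

/-- The inclusion of a subfunctor. -/
def incl (U : SubMod M) : U.toMod ⟶ M :=
  mkHom (fun A => (U.carrier A).subtype) fun _ _ => rfl

instance (U : SubMod M) : Mono U.incl := mono_of_ev_injective _ fun _ => Subtype.val_injective

/-- The quotient of a module by a subfunctor. -/
def quot (U : SubMod M) : RMod k 𝔞 :=
  mkMod (fun A => sec M A ⧸ U.carrier A)
    (fun {A B} g => (U.carrier A).mapQ (U.carrier B) (res M g) fun _ hx => U.res_mem g hx)
    (fun A x => by
      induction x using Submodule.Quotient.induction_on with | _ x => ?_
      exact congrArg _ (res_id x))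
    (fun {A B D} g h x => by
      induction x using Submodule.Quotient.induction_on with | _ x => ?_
      exact congrArg _ (res_res g h x).symm)
    (fun {A B} f g x => by
      induction x using Submodule.Quotient.induction_on with | _ x => ?_
      exact congrArg _ (res_add f g x))
    (fun {A B} r g x => by
      induction x using Submodule.Quotient.induction_on with | _ x => ?_
      exact congrArg _ (res_smul r g x))

/-- The projection to the quotient by a subfunctor. -/
def proj (U : SubMod M) : M ⟶ U.quot :=
  mkHom (fun A => (U.carrier A).mkQ) fun _ _ => rfl

lemma ev_proj_surjective (U : SubMod M) (A : 𝔞) : Function.Surjective (ev U.proj A) :=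
  Submodule.mkQ_surjective _

lemma ev_proj_eq_zero_iff (U : SubMod M) (x : sec M A) :
    ev U.proj A x = 0 ↔ x ∈ U.carrier A := Submodule.Quotient.mk_eq_zero _

instance : PartialOrder (SubMod M) :=
  PartialOrder.lift (fun U => U.carrier) fun _ _ h => SubMod.ext h

end SubMod

namespace LinearSieve

variable {A B D : 𝔞} (R : LinearSieve k A)

/-- A morphism in a covering, viewed as a section of the covering. -/
def mkSec (g : R.arrows B) : sec R.toMod B := g

lemma ev_incl (g : R.arrows B) : ev R.incl B (R.mkSec g) = repSec (g : B ⟶ A) := rfl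

lemma mkSec_surjective (x : sec R.toMod B) : ∃ g, R.mkSec g = x := ⟨x, rfl⟩

end LinearSieve

/-! ### Closures of submodules with respect to a linear topology -/

namespace CoveringSystem

namespace IsTopology

variable {T : CoveringSystem k 𝔞} (hT : T.IsTopology) {M N : RMod k 𝔞} {A B : 𝔞}

include hT

lemma mem_of_pullback_eq_top {R S : LinearSieve k A} (hS : S ∈ T A)
    (h : ∀ (B : 𝔞) (f : B ⟶ A), f ∈ S.arrows B → R.pullback f = LinearSieve.top k B) :
    R ∈ T A :=
  hT.glueing S hS R fun B f hf => h B f hf ▸ hT.top_mem B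

/-- For `f` in `S`, the pullback of `R` along `f` is everything, because `S` is downward closed. -/
lemma mem_of_le {R S : LinearSieve k A} (hS : S ∈ T A)
    (h : ∀ B, S.arrows B ≤ R.arrows B) : R ∈ T A := by
  refine hT.mem_of_pullback_eq_top hS fun B f hf => ?_
  ext D g
  exact ⟨fun _ => trivial, fun _ => h D (S.downward_closed hf g)⟩

/-- In the induction step, pulling `S ∩ R i` back along an arrow of `S` gives a sieve containing the
pullback of `R i`, so glueing over `S` applies. -/
lemma iInf_mem {ι : Type*} [Finite ι] (R : ι → LinearSieve k A) (hR : ∀ i, R i ∈ T A) :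
    ∃ S ∈ T A, ∀ (B : 𝔞) (g : B ⟶ A), g ∈ S.arrows B ↔ ∀ i, g ∈ (R i).arrows B := by
  classical
  have key : ∀ s : Finset ι, ∃ S ∈ T A, ∀ (B : 𝔞) (g : B ⟶ A),
      g ∈ S.arrows B ↔ ∀ i ∈ s, g ∈ (R i).arrows B := by
    intro s
    induction s using Finset.induction_on with
    | empty => exact ⟨_, hT.top_mem A, fun B g => by simp [LinearSieve.top]⟩
    | insert i s _ ih =>
      obtain ⟨S, hS, h⟩ := ih
      refine ⟨⟨fun B => S.arrows B ⊓ (R i).arrows B, fun hf g =>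
        ⟨S.downward_closed hf.1 g, (R i).downward_closed hf.2 g⟩⟩, ?_, fun B g => ?_⟩
      · refine hT.glueing S hS _ fun B f hf => ?_
        refine hT.mem_of_le (hT.pullback_mem _ (hR i) f) fun D g hg => ?_
        exact ⟨S.downward_closed hf g, hg⟩
      · rw [Submodule.mem_inf, h]
        simp [and_comm]
  have := Fintype.ofFinite ι
  obtain ⟨S, hS, h⟩ := key Finset.univ
  exact ⟨S, hS, fun B g => by simpa using h B g⟩

lemma inf_mem {R S : LinearSieve k A} (hR : R ∈ T A) (hS : S ∈ T A) :
    ∃ S' ∈ T A, ∀ (B : 𝔞) (g : B ⟶ A), g ∈ S'.arrows B ↔ g ∈ R.arrows B ∧ g ∈ S.arrows B := by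
  obtain ⟨S', hS', h⟩ := hT.iInf_mem (fun b : Bool => if b then R else S)
    (by rintro (_ | _) <;> simpa)
  exact ⟨S', hS', fun B g => by rw [h]; simp [and_comm]⟩

/-- The sections which locally lie in the subfunctor `U`. -/
def closure (U : SubMod M) : SubMod M where
  carrier A :=
    { carrier := {x | U.sieve x ∈ T A}
      add_mem' := fun {x y} hx hy => by
        obtain ⟨S, hS, h⟩ := hT.inf_mem hx hy
        refine hT.mem_of_le hS fun B g hg => ?_
        rw [SubMod.mem_sieve, map_add]
        exact add_mem ((h B g).1 hg).1 ((h B g).1 hg).2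
      zero_mem' := by
        refine hT.mem_of_le (hT.top_mem A) fun B g _ => ?_
        rw [SubMod.mem_sieve, map_zero]
        exact zero_mem _
      smul_mem' := fun r x hx => by
        refine hT.mem_of_le hx fun B g hg => ?_
        rw [SubMod.mem_sieve, map_smul]
        exact Submodule.smul_mem _ r hg }
  res_mem {A B} g x hx := by
    change U.sieve (res M g x) ∈ T B
    rw [← SubMod.pullback_sieve]
    exact hT.pullback_mem _ hx g

lemma mem_closure (U : SubMod M) (x : sec M A) :
    x ∈ (hT.closure U).carrier A ↔ U.sieve x ∈ T A := Iff.rfl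

lemma le_closure (U : SubMod M) : U ≤ hT.closure U := fun A _ hx =>
  hT.mem_of_le (hT.top_mem A) fun _ g _ => U.res_mem g hx

lemma closure_mono {U V : SubMod M} (h : U ≤ V) : hT.closure U ≤ hT.closure V :=
  fun _ _ hx => hT.mem_of_le hx fun B _ hg => h B hg

/-- This is the glueing axiom, since pulling the sieve of `x` back along `g` gives the sieve of
`M(g)(x)`. It makes closures idempotent. -/
lemma mem_closure_of_local {U : SubMod M} {R : LinearSieve k A} (hR : R ∈ T A) (x : sec M A)
    (h : ∀ (B : 𝔞) (g : B ⟶ A), g ∈ R.arrows B → res M g x ∈ (hT.closure U).carrier B) :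
    x ∈ (hT.closure U).carrier A :=
  hT.glueing R hR _ fun B g hg => by
    rw [SubMod.pullback_sieve]
    exact h B g hg

lemma closure_closure (U : SubMod M) : hT.closure (hT.closure U) = hT.closure U :=
  le_antisymm (fun _ x hx => hT.mem_closure_of_local hx x fun _ _ hg => hg) (hT.le_closure _)

lemma closure_le_closure {U V : SubMod M} (h : U ≤ hT.closure V) :
    hT.closure U ≤ hT.closure V := (hT.closure_mono h).trans (hT.closure_closure V).le

lemma mem_closure_comap (f : M ⟶ N) (U : SubMod N) (x : sec M A) :
    x ∈ (hT.closure (U.comap f)).carrier A ↔ ev f A x ∈ (hT.closure U).carrier A := by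
  rw [mem_closure, mem_closure, SubMod.sieve_comap]

lemma ev_mem_closure (f : M ⟶ N) {U : SubMod M} {V : SubMod N} (h : U ≤ V.comap f)
    {x : sec M A} (hx : x ∈ (hT.closure U).carrier A) : ev f A x ∈ (hT.closure V).carrier A :=
  (hT.mem_closure_comap f V x).1 (hT.closure_mono h A hx)

lemma ev_mem_closure_zero (f : M ⟶ N) {x : sec M A}
    (hx : x ∈ (hT.closure (SubMod.zero M)).carrier A) :
    ev f A x ∈ (hT.closure (SubMod.zero N)).carrier A :=
  hT.ev_mem_closure f (fun A _ hx => by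
    change _ ∈ (⊥ : Submodule k _) at hx
    rw [Submodule.mem_bot] at hx
    rw [hx]
    exact zero_mem _) hx

/-- Together with `isMono_iff`, this lets monotonicity and idempotence of closures replace repeated
choices of coverings. -/
lemma isEpi_iff (f : M ⟶ N) :
    T.IsEpi f ↔ ∀ (A : 𝔞) (y : sec N A), y ∈ (hT.closure (SubMod.range f)).carrier A := by
  refine forall₂_congr fun A y => ⟨fun ⟨R, hR, h⟩ => hT.mem_of_le hR h, fun h => ?_⟩
  exact ⟨_, h, fun B g hg => hg⟩

lemma isMono_iff (f : M ⟶ N) :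
    T.IsMono f ↔ ∀ (A : 𝔞) (x : sec M A), ev f A x = 0 →
      x ∈ (hT.closure (SubMod.zero M)).carrier A := by
  refine forall₂_congr fun A x => imp_congr Iff.rfl
    ⟨fun ⟨R, hR, h⟩ => hT.mem_of_le hR h, fun h => ?_⟩
  exact ⟨_, h, fun B g hg => hg⟩

end IsTopology

/-! ### Sections of sheaves -/

variable (T : CoveringSystem k 𝔞) {M N : RMod k 𝔞} {A B : 𝔞}

/-- A module is separated if its sections are determined locally. -/
def IsSeparated (M : RMod k 𝔞) : Prop :=
  ∀ (A : 𝔞) (R : LinearSieve k A), R ∈ T A → ∀ x : sec M A,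
    (∀ (B : 𝔞) (g : B ⟶ A), g ∈ R.arrows B → res M g x = 0) → x = 0

variable {T}

/-- By Yoneda, an extension to `𝔞(-, A)` is a section at `A`; by linearity, its uniqueness is
separatedness. -/
lemma isSheaf_iff : T.IsSheaf M ↔ T.IsSeparated M ∧
    ∀ (A : 𝔞) (R : LinearSieve k A), R ∈ T A → ∀ φ : R.toMod ⟶ M,
      ∃ x : sec M A, ∀ (B : 𝔞) (g : R.arrows B), ev φ B (R.mkSec g) = res M g.1 x := by
  constructor
  · refine fun h => ⟨fun A R hR x hx => ?_, fun A R hR φ => ?_⟩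
    · have : repHom x = repHom 0 := (h A R hR).1 <| hom_ext_ev fun B g => by
        obtain ⟨g, rfl⟩ := R.mkSec_surjective g
        rw [ev_comp, ev_comp, R.ev_incl, ev_repHom, ev_repHom, map_zero, hx B g.1 g.2]
      have h' := congr(ev $this A (repSec (𝟙 A)))
      rwa [ev_repHom, ev_repHom, res_id, res_id] at h'
    · obtain ⟨ψ, hψ⟩ := (h A R hR).2 φ
      refine ⟨ev ψ A (repSec (𝟙 A)), fun B g => ?_⟩
      rw [← hψ, ← ev_repSec]
      rfl
  · refine fun ⟨hs, he⟩ A R hR => ⟨fun φ ψ h => ?_, fun φ => ?_⟩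
    · refine rep_hom_ext (sub_eq_zero.1 (hs A R hR _ fun B g hg => ?_))
      rw [map_sub, ← ev_repSec, ← ev_repSec]
      exact sub_eq_zero.2 congr(ev $h B (R.mkSec ⟨g, hg⟩))
    · obtain ⟨x, hx⟩ := he A R hR φ
      refine ⟨repHom x, hom_ext_ev fun B g => ?_⟩
      obtain ⟨g, rfl⟩ := R.mkSec_surjective g
      rw [hx]
      rfl

/-- Compatible families of sections of a sheaf glue. -/
lemma IsSheaf.exists_glue (h : T.IsSheaf M) {R : LinearSieve k A} (hR : R ∈ T A)
    (s : ∀ B : 𝔞, (B ⟶ A) → sec M B)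
    (add : ∀ (B : 𝔞) (f g : B ⟶ A), f ∈ R.arrows B → g ∈ R.arrows B →
      s B (f + g) = s B f + s B g)
    (smul : ∀ (B : 𝔞) (r : k) (g : B ⟶ A), g ∈ R.arrows B → s B (r • g) = r • s B g)
    (nat : ∀ (B D : 𝔞) (g : B ⟶ A) (h : D ⟶ B), g ∈ R.arrows B →
      s D (h ≫ g) = res M h (s B g)) :
    ∃ z : sec M A, ∀ (B : 𝔞) (g : B ⟶ A), g ∈ R.arrows B → s B g = res M g z := by
  let φ (B : 𝔞) : R.arrows B →ₗ[k] sec M B :=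
    { toFun := fun g => s B g.1
      map_add' := fun f g => add B f.1 g.1 f.2 g.2
      map_smul' := fun r g => smul B r g.1 g.2 }
  obtain ⟨z, hz⟩ := (isSheaf_iff.1 h).2 A R hR
    (mkHom (M := R.toMod) φ fun {B D} g x => nat B D x.1 g x.2)
  exact ⟨z, fun B g hg => hz B ⟨g, hg⟩⟩

lemma IsSheaf.isSeparated (h : T.IsSheaf M) : T.IsSeparated M := (isSheaf_iff.1 h).1

lemma IsSheaf.of_isIso (h : T.IsSheaf M) (f : M ⟶ N) [IsIso f] : T.IsSheaf N := by
  rw [isSheaf_iff] at h ⊢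
  refine ⟨fun A R hR x hx => ?_, fun A R hR φ => ?_⟩
  · have : ev (inv f) A x = 0 := h.1 A R hR _ fun B g hg => by
      rw [← ev_res, hx B g hg, map_zero]
    rw [← ev_id (M := N) x, ← IsIso.inv_hom_id f, ev_comp, this, map_zero]
  · obtain ⟨x, hx⟩ := h.2 A R hR (φ ≫ inv f)
    refine ⟨ev f A x, fun B g => ?_⟩
    rw [← ev_res, ← hx, ← ev_comp]
    simp

/-- Morphisms to a separated module are determined along `T`-epimorphisms. -/
lemma hom_ext_of_isEpi {f : M ⟶ N} (hf : T.IsEpi f) {P : RMod k 𝔞} (hP : T.IsSeparated P)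
    {φ ψ : N ⟶ P} (h : f ≫ φ = f ≫ ψ) : φ = ψ := by
  refine hom_ext_ev fun A y => sub_eq_zero.1 ?_
  obtain ⟨R, hR, hx⟩ := hf A y
  refine hP A R hR _ fun B g hg => ?_
  obtain ⟨x, hx⟩ := hx B g hg
  change ev f B x = res N g y at hx
  rw [map_sub, ← ev_res, ← ev_res, ← hx, ← ev_comp, ← ev_comp, h, sub_self]

/-! ### Extension of morphisms to sheaves along local isomorphisms. -/

namespace IsTopology

variable (hT : T.IsTopology)
include hT

lemma isSeparated_iff :
    T.IsSeparated M ↔ ∀ (A : 𝔞) (x : sec M A), x ∈ (hT.closure (SubMod.zero M)).carrier A → x = 0 :=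
  ⟨fun h A x hx => h A _ hx x fun _ _ hg => hg,
    fun h A _ hR x hx => h A x (hT.mem_of_le hR hx)⟩

/-- A morphism to a sheaf extends along every `T`-isomorphism. -/
lemma exists_extension {f : M ⟶ N} (hf : T.IsEpi f) (hf' : T.IsMono f) {P : RMod k 𝔞}
    (hP : T.IsSheaf P) (φ : M ⟶ P) : ∃ ψ : N ⟶ P, f ≫ ψ = φ := by
  have hs := hP.isSeparated
  -- Two lifts along `f` differ by a locally zero section, which `φ` kills since `P` is separated.
  have h0 : ∀ (B : 𝔞) (x x' : sec M B), ev f B x = ev f B x' → ev φ B x = ev φ B x' := by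
    intro B x x' hxx
    rw [← sub_eq_zero, ← map_sub] at hxx ⊢
    exact (hT.isSeparated_iff.1 hs) B _ (hT.ev_mem_closure_zero φ ((hT.isMono_iff f).1 hf' B _ hxx))
  -- The value `z` is characterised by all local lifts of `y`, not by chosen ones, so linearity and
  -- naturality can later be checked locally.
  have key : ∀ (A : 𝔞) (y : sec N A), ∃ z : sec P A, ∀ (B : 𝔞) (g : B ⟶ A) (x : sec M B),
      ev f B x = res N g y → ev φ B x = res P g z := by
    intro A y
    have hR : (SubMod.range f).sieve y ∈ T A := (hT.isEpi_iff f).1 hf A y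
    set R := (SubMod.range f).sieve y
    have hR' : ∀ (B : 𝔞) (g : B ⟶ A), ∃ x : sec M B, g ∈ R.arrows B → ev f B x = res N g y := by
      intro B g
      by_cases hg : g ∈ R.arrows B
      · obtain ⟨x, hx⟩ := hg
        exact ⟨x, fun _ => hx⟩
      · exact ⟨0, fun h => absurd h hg⟩
    choose s hs' using hR'
    obtain ⟨z, hz⟩ := hP.exists_glue hR (fun B g => ev φ B (s B g))
      (fun B g g' hg hg' => by
        rw [← map_add]
        refine h0 B _ _ ?_
        rw [hs' _ _ (add_mem hg hg'), map_add, hs' _ _ hg, hs' _ _ hg', ← res_add])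
      (fun B r g hg => by
        rw [← map_smul]
        refine h0 B _ _ ?_
        rw [hs' _ _ (Submodule.smul_mem _ r hg), map_smul, hs' _ _ hg, ← res_smul])
      (fun B D g h hg => by
        rw [← ev_res]
        refine h0 D _ _ ?_
        rw [hs' _ _ (R.downward_closed hg h), ev_res, hs' _ _ hg, res_res])
    refine ⟨z, fun B g x hx => ?_⟩
    have hg : g ∈ R.arrows B := ⟨x, hx⟩
    rw [← hz B g hg]
    refine h0 B _ _ ?_
    rw [hx, hs' _ _ hg]
  choose t ht using key
  have hmem := (hT.isEpi_iff f).1 hf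
  refine ⟨mkHom (fun A =>
    { toFun := t A
      map_add' := fun y y' => ?_
      map_smul' := fun r y => ?_ }) fun {A B} g y => ?_, hom_ext_ev fun A x => ?_⟩
  · obtain ⟨S, hS, h⟩ := hT.inf_mem (hmem A y) (hmem A y')
    refine sub_eq_zero.1 (hs A S hS _ fun B g hg => ?_)
    obtain ⟨⟨x, hx⟩, ⟨x', hx'⟩⟩ := (h B g).1 hg
    have hxx : ev f B (x + x') = res N g (y + y') := by
      rw [map_add, map_add]
      exact congr_arg₂ _ hx hx'
    rw [map_sub, map_add, ← ht A y B g x hx, ← ht A y' B g x' hx', ← ht A _ B g _ hxx, map_add,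
      sub_self]
  · refine sub_eq_zero.1 (hs A _ (hmem A y) _ fun B g hg => ?_)
    obtain ⟨x, hx⟩ := hg
    have hxx : ev f B (r • x) = res N g (r • y) := by
      rw [map_smul, map_smul]
      exact congr_arg _ hx
    rw [RingHom.id_apply, map_sub, map_smul, ← ht A y B g x hx, ← ht A _ B g _ hxx, map_smul,
      sub_self]
  · refine sub_eq_zero.1 (hs B _ (hmem B (res N g y)) _ fun D h hg => ?_)
    obtain ⟨x, hx⟩ := hg
    have hxx : ev f D x = res N h (res N g y) := hx
    change res P h (t B (res N g y) - res P g (t A y)) = 0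
    rw [map_sub, ← ht B _ D h x hx, res_res, ← ht A y D (h ≫ g) x (by rw [hxx, res_res]), sub_self]
  · change t A (ev f A x) = ev φ A x
    rw [ht A (ev f A x) A (𝟙 A) x (by rw [res_id]), res_id]

/-- Extending `𝟙 M` along `f` gives `g` with `f ≫ g = 𝟙 M`; then `g ≫ f` and `𝟙 N` agree after `f`,
hence agree. -/
lemma isIso_of_isSheaf {f : M ⟶ N} (hf : T.IsEpi f) (hf' : T.IsMono f) (hM : T.IsSheaf M)
    (hN : T.IsSheaf N) : IsIso f := by
  obtain ⟨g, hg⟩ := hT.exists_extension hf hf' hM (𝟙 M)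
  refine ⟨g, hg, hom_ext_of_isEpi hf hN.isSeparated ?_⟩
  rw [← Category.assoc, hg, Category.id_comp, Category.comp_id]

end IsTopology

end CoveringSystem

/-! ### Embedding a separated module in a sheaf -/

namespace CoveringSystem

variable {M : RMod k 𝔞}

/-- A family of sections of `M` indexed by all morphisms to `A` is compatible on `R` if its
restriction to `R` is a morphism of modules. -/
structure IsCompatibleOn {A : 𝔞} (R : LinearSieve k A) (s : ∀ B : 𝔞, (B ⟶ A) → sec M B) :
    Prop where
  add : ∀ (B : 𝔞) (f g : B ⟶ A), f ∈ R.arrows B → g ∈ R.arrows B → s B (f + g) = s B f + s B g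
  smul : ∀ (B : 𝔞) (r : k) (g : B ⟶ A), g ∈ R.arrows B → s B (r • g) = r • s B g
  nat : ∀ (B D : 𝔞) (g : B ⟶ A) (h : D ⟶ B), g ∈ R.arrows B → s D (h ≫ g) = res M h (s B g)

lemma IsCompatibleOn.mono {A : 𝔞} {R S : LinearSieve k A} {s : ∀ B : 𝔞, (B ⟶ A) → sec M B}
    (h : IsCompatibleOn R s) (hS : ∀ (B : 𝔞) (g : B ⟶ A), g ∈ S.arrows B → g ∈ R.arrows B) :
    IsCompatibleOn S s where
  add B f g hf hg := h.add B f g (hS B f hf) (hS B g hg)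
  smul B r g hg := h.smul B r g (hS B g hg)
  nat B D g h' hg := h.nat B D g h' (hS B g hg)

lemma IsCompatibleOn.pullback {A B : 𝔞} {R : LinearSieve k A} {s : ∀ B : 𝔞, (B ⟶ A) → sec M B}
    (h : IsCompatibleOn R s) (g : B ⟶ A) :
    IsCompatibleOn (R.pullback g) fun D f => s D (f ≫ g) where
  add D f f' hf hf' := by
    rw [Preadditive.add_comp]
    exact h.add D _ _ hf hf'
  smul D r f hf := by
    rw [Linear.smul_comp]
    exact h.smul D r _ hf
  nat D E f f' hf := by
    rw [Category.assoc]
    exact h.nat D E _ f' hf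

namespace IsTopology

variable {T : CoveringSystem k 𝔞} (hT : T.IsTopology)

variable (M) in
/-- The families of sections which are compatible on some covering. -/
def compatible (A : 𝔞) : Submodule k (∀ B : 𝔞, (B ⟶ A) → sec M B) where
  carrier := {s | ∃ R ∈ T A, IsCompatibleOn R s}
  add_mem' := by
    rintro s t ⟨R, hR, hs⟩ ⟨S, hS, ht⟩
    obtain ⟨S', hS', h⟩ := hT.inf_mem hR hS
    have hs := hs.mono fun B g hg => ((h B g).1 hg).1
    have ht := ht.mono fun B g hg => ((h B g).1 hg).2
    refine ⟨S', hS', ⟨fun B f g hf hg => ?_, fun B r g hg => ?_, fun B D g g' hg => ?_⟩⟩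
    · simp only [Pi.add_apply, hs.add B f g hf hg, ht.add B f g hf hg]
      abel
    · simp only [Pi.add_apply, hs.smul B r g hg, ht.smul B r g hg, smul_add]
    · simp only [Pi.add_apply, hs.nat B D g g' hg, ht.nat B D g g' hg, map_add]
  zero_mem' := ⟨_, hT.top_mem A, ⟨by simp, by simp, by simp⟩⟩
  smul_mem' := by
    rintro c s ⟨R, hR, hs⟩
    refine ⟨R, hR, ⟨fun B f g hf hg => ?_, fun B r g hg => ?_, fun B D g g' hg => ?_⟩⟩
    · simp only [Pi.smul_apply, hs.add B f g hf hg, smul_add]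
    · simp only [Pi.smul_apply, hs.smul B r g hg, smul_comm r c]
    · simp only [Pi.smul_apply, hs.nat B D g g' hg, map_smul]

variable (M) in
/-- The families of sections which vanish on some covering. -/
def locallyZero (A : 𝔞) : Submodule k (hT.compatible M A) where
  carrier := {s | ∃ R ∈ T A, ∀ (B : 𝔞) (g : B ⟶ A), g ∈ R.arrows B → s.1 B g = 0}
  add_mem' := by
    rintro s t ⟨R, hR, hs⟩ ⟨S, hS, ht⟩
    obtain ⟨S', hS', h⟩ := hT.inf_mem hR hS
    refine ⟨S', hS', fun B g hg => ?_⟩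
    have h1 := hs B g ((h B g).1 hg).1
    have h2 := ht B g ((h B g).1 hg).2
    change s.1 B g + t.1 B g = 0
    rw [h1, h2, add_zero]
  zero_mem' := ⟨_, hT.top_mem A, fun _ _ _ => rfl⟩
  smul_mem' := by
    rintro c s ⟨R, hR, hs⟩
    refine ⟨R, hR, fun B g hg => ?_⟩
    change c • s.1 B g = 0
    rw [hs B g hg, smul_zero]

/-- Restriction of compatible families. -/
def compatibleRes {A B : 𝔞} (g : B ⟶ A) : hT.compatible M A →ₗ[k] hT.compatible M B where
  toFun s := ⟨fun D f => s.1 D (f ≫ g), by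
    obtain ⟨R, hR, hs⟩ := s.2
    exact ⟨_, hT.pullback_mem R hR g, hs.pullback g⟩⟩
  map_add' _ _ := rfl
  map_smul' _ _ := rfl

lemma compatibleRes_mem {A B : 𝔞} (g : B ⟶ A) {s : hT.compatible M A}
    (hs : s ∈ hT.locallyZero M A) : hT.compatibleRes g s ∈ hT.locallyZero M B := by
  obtain ⟨R, hR, hs⟩ := hs
  exact ⟨_, hT.pullback_mem R hR g, fun D f hf => hs D _ hf⟩

variable (M) in
/-- The module whose sections at `A` are the germs of compatible families on coverings of `A`. -/
def plus : RMod k 𝔞 :=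
  mkMod (fun A => hT.compatible M A ⧸ hT.locallyZero M A)
    (fun {A B} g => (hT.locallyZero M A).mapQ (hT.locallyZero M B) (hT.compatibleRes g)
      fun _ hs => hT.compatibleRes_mem g hs)
    (fun A x => by
      induction x using Submodule.Quotient.induction_on with | _ x => ?_
      refine congrArg _ (Subtype.ext (funext₂ fun D f => ?_))
      exact congrArg _ (Category.comp_id f))
    (fun {A B D} g h x => by
      induction x using Submodule.Quotient.induction_on with | _ x => ?_
      refine congrArg _ (Subtype.ext (funext₂ fun D f => ?_))
      exact congrArg _ (Category.assoc f h g).symm)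
    (fun {A B} f g x => by
      induction x using Submodule.Quotient.induction_on with | _ x => ?_
      refine (Submodule.Quotient.eq _).2 ?_
      obtain ⟨R, hR, hs⟩ := x.2
      -- The family is additive only on `R`, so the identity is checked on those `e` for which both
      -- `e ≫ f` and `e ≫ g` lie in `R`.
      obtain ⟨S, hS, h⟩ := hT.inf_mem (hT.pullback_mem R hR f) (hT.pullback_mem R hR g)
      refine ⟨S, hS, fun D e he => ?_⟩
      change x.1 D (e ≫ (f + g)) - (x.1 D (e ≫ f) + x.1 D (e ≫ g)) = 0
      rw [Preadditive.comp_add, hs.add D (e ≫ f) (e ≫ g) ((h D e).1 he).1 ((h D e).1 he).2, sub_self])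
    (fun {A B} r g x => by
      induction x using Submodule.Quotient.induction_on with | _ x => ?_
      refine (Submodule.Quotient.eq _).2 ?_
      obtain ⟨R, hR, hs⟩ := x.2
      refine ⟨_, hT.pullback_mem R hR g, fun D e he => ?_⟩
      change x.1 D (e ≫ (r • g)) - r • x.1 D (e ≫ g) = 0
      rw [Linear.comp_smul, hs.smul D r (e ≫ g) he, sub_self])

/-- The germ of a compatible family. -/
def germ (A : 𝔞) : hT.compatible M A →ₗ[k] sec (hT.plus M) A := (hT.locallyZero M A).mkQ

lemma germ_surjective (A : 𝔞) : Function.Surjective (hT.germ (M := M) A) :=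
  Submodule.mkQ_surjective _

lemma germ_eq_zero_iff {A : 𝔞} (s : hT.compatible M A) :
    hT.germ A s = 0 ↔ ∃ R ∈ T A, ∀ (B : 𝔞) (g : B ⟶ A), g ∈ R.arrows B → s.1 B g = 0 :=
  Submodule.Quotient.mk_eq_zero _

lemma res_germ {A B : 𝔞} (g : B ⟶ A) (s : hT.compatible M A) :
    res (hT.plus M) g (hT.germ A s) = hT.germ B (hT.compatibleRes g s) := rfl

/-- The family of all restrictions of a section. -/
def family (A : 𝔞) : sec M A →ₗ[k] hT.compatible M A where
  toFun x := ⟨fun _ g => res M g x, _, hT.top_mem A,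
    ⟨fun _ f g _ _ => res_add f g x, fun _ r g _ => res_smul r g x,
      fun _ _ g h _ => (res_res g h x).symm⟩⟩
  map_add' x y := Subtype.ext (funext₂ fun _ g => map_add (res M g) x y)
  map_smul' r x := Subtype.ext (funext₂ fun _ g => map_smul (res M g) r x)

variable (M) in
/-- The canonical morphism `M ⟶ M⁺`. -/
def toPlus : M ⟶ hT.plus M :=
  mkHom (fun A => hT.germ A ∘ₗ hT.family A) fun {A B} g x => by
    change hT.germ B (hT.family B (res M g x)) = hT.germ B (hT.compatibleRes g (hT.family A x))
    refine congrArg _ (Subtype.ext (funext₂ fun D f => ?_))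
    exact res_res g f x

lemma ev_toPlus {A : 𝔞} (x : sec M A) : ev (hT.toPlus M) A x = hT.germ A (hT.family A x) := rfl

/-- Along an arrow `g` of `R`, compatibility turns the restricted family into the family of all
restrictions of the single section `s g`. -/
lemma res_germ_of_isCompatibleOn {A B : 𝔞} {R : LinearSieve k A} (s : hT.compatible M A)
    (hs : IsCompatibleOn R s.1) (g : B ⟶ A) (hg : g ∈ R.arrows B) :
    res (hT.plus M) g (hT.germ A s) = ev (hT.toPlus M) B (s.1 B g) := by
  rw [res_germ, ev_toPlus]
  exact congrArg _ (Subtype.ext (funext₂ fun D f => hs.nat B D g f hg))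

lemma isEpi_toPlus : T.IsEpi (hT.toPlus M) := by
  intro A y
  obtain ⟨s, rfl⟩ := hT.germ_surjective A y
  obtain ⟨R, hR, hs⟩ := s.2
  exact ⟨R, hR, fun B g hg => ⟨_, (hT.res_germ_of_isCompatibleOn s hs g hg).symm⟩⟩

variable (hM : T.IsSeparated M)
include hM

lemma toPlus_injective (A : 𝔞) : Function.Injective (ev (hT.toPlus M) A) := by
  refine (injective_iff_map_eq_zero _).2 fun x hx => ?_
  obtain ⟨R, hR, h⟩ := (hT.germ_eq_zero_iff _).1 hx
  exact hM A R hR x h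

lemma isSeparated_plus : T.IsSeparated (hT.plus M) := by
  intro A R hR y hy
  obtain ⟨s, rfl⟩ := hT.germ_surjective A y
  obtain ⟨R', hR', hs⟩ := s.2
  obtain ⟨S, hS, h⟩ := hT.inf_mem hR hR'
  refine (hT.germ_eq_zero_iff _).2 ⟨S, hS, fun B g hg => ?_⟩
  refine hT.toPlus_injective hM B ?_
  rw [← hT.res_germ_of_isCompatibleOn s hs g ((h B g).1 hg).2, hy B g ((h B g).1 hg).1, map_zero]

/-- One plus construction suffices for separated `M`: lifts along the injective `toPlus` are unique,
so a morphism `R ⟶ M⁺` becomes, on a smaller covering, a compatible family in `M`, whose germ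
extends it. -/
lemma isSheaf_plus : T.IsSheaf (hT.plus M) := by
  refine isSheaf_iff.2 ⟨hT.isSeparated_plus hM, fun A R hR φ => ?_⟩
  let U := (SubMod.range (hT.toPlus M)).comap φ
  -- The arrows of `R` at which `φ` takes a value coming from `M`; they form a covering because
  -- `toPlus` is a `T`-epimorphism.
  let R' : LinearSieve k A :=
    { arrows := fun B => (U.carrier B).map (R.arrows B).subtype
      downward_closed := by
        rintro B D _ ⟨f, hf, rfl⟩ g
        exact ⟨_, U.res_mem g hf, rfl⟩ }
  have hR'mem : ∀ (B : 𝔞) (g : B ⟶ A), g ∈ R'.arrows B ↔ ∃ hg : g ∈ R.arrows B,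
      ∃ x : sec M B, ev (hT.toPlus M) B x = ev φ B (R.mkSec ⟨g, hg⟩) := by
    intro B g
    constructor
    · rintro ⟨f, ⟨x, hx⟩, rfl⟩
      exact ⟨f.2, x, hx⟩
    · rintro ⟨hg, x, hx⟩
      exact ⟨⟨g, hg⟩, ⟨x, hx⟩, rfl⟩
  have hR' : R' ∈ T A := by
    refine hT.glueing R hR _ fun B f hf => ?_
    refine hT.mem_of_le ((hT.isEpi_iff _).1 hT.isEpi_toPlus B (ev φ B (R.mkSec ⟨f, hf⟩)))
      fun D g hg => ?_
    refine (hR'mem D (g ≫ f)).2 ⟨R.downward_closed hf g, ?_⟩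
    obtain ⟨x, hx⟩ := hg
    exact ⟨x, hx.trans (ev_res φ g _).symm⟩
  have hex : ∀ (B : 𝔞) (g : B ⟶ A), ∃ x : sec M B, ∀ hg : g ∈ R'.arrows B,
      ev (hT.toPlus M) B x = ev φ B (R.mkSec ⟨g, ((hR'mem B g).1 hg).1⟩) := by
    intro B g
    by_cases hg : g ∈ R'.arrows B
    · obtain ⟨x, hx⟩ := ((hR'mem B g).1 hg).2
      exact ⟨x, fun _ => hx⟩
    · exact ⟨0, fun h => absurd h hg⟩
  choose s hs using hex
  have hcomp : IsCompatibleOn R' s := by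
    refine ⟨fun B f g hf hg => ?_, fun B r g hg => ?_, fun B D g h hg => ?_⟩ <;>
      apply hT.toPlus_injective hM
    · rw [hs _ _ (add_mem hf hg), map_add, hs _ _ hf, hs _ _ hg, ← map_add]
      rfl
    · rw [hs _ _ (Submodule.smul_mem _ r hg), map_smul, hs _ _ hg, ← map_smul]
      rfl
    · rw [hs _ _ (R'.downward_closed hg h), ev_res, hs _ _ hg, ← ev_res]
      rfl
  -- The germ agrees with `φ` on `R'` by construction; at any other arrow `g` of `R`, equality is
  -- tested on the pullback of `R'` along `g`.
  refine ⟨hT.germ A ⟨s, R', hR', hcomp⟩, fun B g => sub_eq_zero.1 ?_⟩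
  refine hT.isSeparated_plus hM B _ (hT.pullback_mem R' hR' g.1) _ fun D h hh => ?_
  have hh' : h ≫ g.1 ∈ R'.arrows D := hh
  rw [map_sub, res_res, hT.res_germ_of_isCompatibleOn ⟨s, R', hR', hcomp⟩ hcomp _ hh', hs _ _ hh',
    ← ev_res]
  exact sub_self _

end IsTopology

/-! ### Detecting local properties by morphisms to sheaves -/

namespace IsTopology

variable {T : CoveringSystem k 𝔞} (hT : T.IsTopology) {N : RMod k 𝔞}
include hT

/-- The closure of a subfunctor is the kernel of a morphism to a sheaf. -/
lemma exists_sheaf_ker_eq_closure (U : SubMod M) : ∃ (F : RMod k 𝔞) (_ : T.IsSheaf F) (φ : M ⟶ F),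
    ∀ (A : 𝔞) (x : sec M A), ev φ A x = 0 ↔ x ∈ (hT.closure U).carrier A := by
  have hsep : T.IsSeparated (hT.closure U).quot := by
    intro A R hR x hx
    obtain ⟨x, rfl⟩ := SubMod.ev_proj_surjective _ A x
    rw [SubMod.ev_proj_eq_zero_iff]
    refine hT.mem_closure_of_local hR x fun B g hg => ?_
    rw [← SubMod.ev_proj_eq_zero_iff, ev_res]
    exact hx B g hg
  refine ⟨_, hT.isSheaf_plus hsep, (hT.closure U).proj ≫ hT.toPlus _, fun A x => ?_⟩
  rw [ev_comp, map_eq_zero_iff _ (hT.toPlus_injective hsep A), SubMod.ev_proj_eq_zero_iff]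

/-- The morphism to a sheaf with kernel the closure of the image of `f` vanishes after `f`, hence is
zero, so that closure is everything. -/
lemma isEpi_of_forall_isSheaf (f : M ⟶ N)
    (h : ∀ F : RMod k 𝔞, T.IsSheaf F → ∀ φ ψ : N ⟶ F, f ≫ φ = f ≫ ψ → φ = ψ) : T.IsEpi f := by
  obtain ⟨F, hF, φ, hφ⟩ := hT.exists_sheaf_ker_eq_closure (SubMod.range f)
  have : φ = 0 := h F hF _ _ <| hom_ext_ev fun A x =>
    (hφ A (ev f A x)).2 (hT.le_closure _ A ⟨x, rfl⟩)
  refine (hT.isEpi_iff f).2 fun A y => (hφ A y).1 ?_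
  rw [this]
  rfl

lemma isMono_of_forall_isSheaf (f : M ⟶ N)
    (h : ∀ F : RMod k 𝔞, T.IsSheaf F → ∀ φ : (SubMod.ker f).toMod ⟶ F, φ = 0) : T.IsMono f := by
  obtain ⟨F, hF, φ, hφ⟩ := hT.exists_sheaf_ker_eq_closure (SubMod.zero (SubMod.ker f).toMod)
  refine (hT.isMono_iff f).2 fun A x hx => ?_
  let x' : sec (SubMod.ker f).toMod A := ⟨x, hx⟩
  refine hT.ev_mem_closure_zero (SubMod.ker f).incl (x := x') ((hφ A x').1 ?_)
  rw [h F hF φ]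
  rfl

end IsTopology

end CoveringSystem

/-! ### The functor induced by a linear functor -/

section Functors

variable {𝒞 : Type u} [Category.{v} 𝒞] [Abelian 𝒞] [Linear k 𝒞]

section Sections

variable (u : 𝔞 ⥤ 𝒞) [u.Additive] [u.Linear k] {A B : 𝔞} {X Y : 𝒞}

variable (k) in
/-- A morphism `u(B) ⟶ X`, viewed as a section of `𝒞(u(-), X)`. -/
def homSec (f : u.obj B ⟶ X) : sec ((inducedFunctor k u).obj X) B := f

lemma homSec_injective {f g : u.obj B ⟶ X} (h : homSec k u f = homSec k u g) : f = g := h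

lemma homSec_surjective (x : sec ((inducedFunctor k u).obj X) B) : ∃ f, homSec k u f = x :=
  ⟨x, rfl⟩

lemma homSec_add (f g : u.obj B ⟶ X) : homSec k u (f + g) = homSec k u f + homSec k u g := rfl

lemma homSec_zero : homSec k u (0 : u.obj B ⟶ X) = 0 := rfl

lemma res_homSec (g : A ⟶ B) (f : u.obj B ⟶ X) :
    res ((inducedFunctor k u).obj X) g (homSec k u f) = homSec k u (u.map g ≫ f) := rfl

lemma ev_map_homSec (c : X ⟶ Y) (f : u.obj B ⟶ X) :
    ev ((inducedFunctor k u).map c) B (homSec k u f) = homSec k u (f ≫ c) := rfl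

lemma ev_repToHomMod (g : B ⟶ A) :
    ev (repToHomMod k u A) B (repSec g) = homSec k u (u.map g) := rfl

end Sections

/-! ### From a localization to the six local conditions. -/

section Localization

variable {u : 𝔞 ⥤ 𝒞} [u.Additive] [u.Linear k] {T : CoveringSystem k 𝔞}

lemma FactorsThroughEquivSh.isSheaf (h : FactorsThroughEquivSh u T) (X : 𝒞) :
    T.IsSheaf ((inducedFunctor k u).obj X) := by
  obtain ⟨e, ⟨i⟩⟩ := h
  exact (e.functor.obj X).property.of_isIso (i.hom.app X)

lemma FactorsThroughEquivSh.exists_iso (h : FactorsThroughEquivSh u T) {F : RMod k 𝔞}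
    (hF : T.IsSheaf F) : ∃ X : 𝒞, Nonempty (F ≅ (inducedFunctor k u).obj X) := by
  obtain ⟨e, ⟨i⟩⟩ := h
  let F' : T.Sh := ⟨F, hF⟩
  exact ⟨e.inverse.obj F', ⟨(T.shIncl.mapIso (e.counitIso.app F')).symm ≪≫
    i.app (e.inverse.obj F')⟩⟩

lemma FactorsThroughEquivSh.isEpi (h : FactorsThroughEquivSh u T) (hT : T.IsTopology)
    {M N : RMod k 𝔞} (f : M ⟶ N) (hf : ∀ X : 𝒞, Function.Injective
      fun φ : N ⟶ (inducedFunctor k u).obj X => f ≫ φ) : T.IsEpi f := by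
  refine hT.isEpi_of_forall_isSheaf f fun F hF φ ψ hφψ => ?_
  obtain ⟨X, ⟨i⟩⟩ := h.exists_iso hF
  rw [← cancel_mono i.hom]
  refine hf X ?_
  simp only [← Category.assoc, hφψ]

lemma FactorsThroughEquivSh.isMono (h : FactorsThroughEquivSh u T) (hT : T.IsTopology)
    {a : RMod k 𝔞 ⥤ 𝒞} (adj : a ⊣ inducedFunctor k u) [PreservesFiniteLimits a]
    {M N : RMod k 𝔞} (f : M ⟶ N) (hf : ∀ X : 𝒞, Function.Bijective
      fun φ : N ⟶ (inducedFunctor k u).obj X => f ≫ φ) : T.IsMono f := by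
  have : IsIso (a.map f) := by
    refine isIso_of_coyoneda_map_bijective _ fun X => ?_
    have : (fun φ : a.obj N ⟶ X => a.map f ≫ φ) =
        (adj.homEquiv M X).symm ∘ (fun φ => f ≫ φ) ∘ adj.homEquiv N X := by
      ext φ
      simp [Adjunction.homEquiv_naturality_left_symm]
    rw [this]
    exact (adj.homEquiv M X).symm.bijective.comp ((hf X).comp (adj.homEquiv N X).bijective)
  refine hT.isMono_of_forall_isSheaf f fun F hF φ => ?_
  obtain ⟨X, ⟨i⟩⟩ := h.exists_iso hF
  -- Writing zero as an endomorphism of the kernel avoids additivity of `a`: since `a` preserves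
  -- monomorphisms and `a.map f` is invertible, `a` identifies `𝟙` and `0` on the kernel.
  have h0 : (SubMod.ker f).incl ≫ f = 0 ≫ (SubMod.ker f).incl ≫ f :=
    hom_ext_ev fun A x => x.2.trans (map_zero (ev ((SubMod.ker f).incl ≫ f) A)).symm
  have h1 : a.map (𝟙 (SubMod.ker f).toMod) = a.map 0 := by
    rw [← cancel_mono (a.map (SubMod.ker f).incl), ← cancel_mono (a.map f)]
    simpa only [← a.map_comp, Category.id_comp, Category.assoc] using congr(a.map $h0)
  rw [← cancel_mono i.hom, ← Category.id_comp (φ ≫ i.hom), zero_comp]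
  apply (adj.homEquiv _ X).symm.injective
  rw [adj.homEquiv_naturality_left_symm, h1, ← adj.homEquiv_naturality_left_symm, zero_comp]

lemma isGenerating_of_faithful (h : (inducedFunctor k u).Faithful) : IsGenerating u := by
  intro X Y f g hfg
  refine (inducedFunctor k u).map_injective (hom_ext_ev fun A x => ?_)
  obtain ⟨x, rfl⟩ := homSec_surjective u x
  rw [ev_map_homSec, ev_map_homSec, hfg (u.obj A) ⟨A⟩ x]

lemma faithful_inducedFunctor (hgen : IsGenerating u) : (inducedFunctor k u).Faithful where
  map_injective {X Y f g} hfg := by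
    refine hgen _ _ ?_
    rintro _ ⟨A⟩ h
    exact homSec_injective (k := k) u congr(ev $hfg A (homSec k u h))

/-- Both sides are `𝒞(u(A), X)`: the source by fullness of `i`, the target by Yoneda. -/
lemma bijective_repToHomMod_comp (h : (inducedFunctor k u).Full) (A : 𝔞) (X : 𝒞) :
    Function.Bijective
      fun φ : (inducedFunctor k u).obj (u.obj A) ⟶ (inducedFunctor k u).obj X =>
        repToHomMod k u A ≫ φ := by
  constructor
  · intro φ ψ hφψ
    obtain ⟨φ, rfl⟩ := (inducedFunctor k u).map_surjective φ
    obtain ⟨ψ, rfl⟩ := (inducedFunctor k u).map_surjective ψ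
    congr 1
    have := congr(ev $hφψ A (repSec (𝟙 A)))
    simp only [ev_comp, ev_repToHomMod, ev_map_homSec, u.map_id, Category.id_comp] at this
    exact homSec_injective u this
  · intro φ
    obtain ⟨c, hc⟩ := homSec_surjective u (ev φ A (repSec (𝟙 A)))
    refine ⟨(inducedFunctor k u).map c, rep_hom_ext ?_⟩
    simp only [ev_comp, ev_repToHomMod, ev_map_homSec, u.map_id, Category.id_comp, hc]

/-- As `i` is fully faithful, cocones on `F ⋙ i` with vertex `i X` are cocones on `F` with vertex
`X`. -/
lemma bijective_colimitComparison_comp (h : (inducedFunctor k u).Full)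
    (h' : (inducedFunctor k u).Faithful) {J : Type v} [SmallCategory J] {F : J ⥤ 𝒞}
    {c : Cocone F} (hc : IsColimit c) {d : Cocone (F ⋙ inducedFunctor k u)} (hd : IsColimit d)
    (X : 𝒞) : Function.Bijective
      fun φ : (inducedFunctor k u).obj c.pt ⟶ (inducedFunctor k u).obj X =>
        hd.desc ((inducedFunctor k u).mapCocone c) ≫ φ := by
  constructor
  · intro φ ψ hφψ
    obtain ⟨φ, rfl⟩ := (inducedFunctor k u).map_surjective φ
    obtain ⟨ψ, rfl⟩ := (inducedFunctor k u).map_surjective ψ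
    congr 1
    refine hc.hom_ext fun j => (inducedFunctor k u).map_injective ?_
    have := congr(d.ι.app j ≫ $hφψ)
    simpa only [hd.fac_assoc, Functor.mapCocone_ι_app, ← Functor.map_comp] using this
  · intro φ
    let s : Cocone F :=
      { pt := X
        ι :=
          { app := fun j => (inducedFunctor k u).preimage (d.ι.app j ≫ φ)
            naturality := fun j j' g => (inducedFunctor k u).map_injective (by
              simpa using congr($(d.w g) ≫ φ)) } }
    refine ⟨(inducedFunctor k u).map (hc.desc s), hd.hom_ext fun j => ?_⟩
    change d.ι.app j ≫ hd.desc _ ≫ _ = _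
    rw [hd.fac_assoc, Functor.mapCocone_ι_app, ← Functor.map_comp, hc.fac, Functor.map_preimage]

/-- A morphism out of `u(A)` killed by all `u(f)`, `f ∈ R`, is a section that vanishes on `R`. -/
lemma isTAmple_of_isSeparated [IsGrothendieckAbelian.{v} 𝒞]
    (h : ∀ X : 𝒞, T.IsSeparated ((inducedFunctor k u).obj X)) : IsTAmple u T := by
  refine fun A R hR => Preadditive.epi_of_cancel_zero _ fun {X} g hg => homSec_injective (k := k) u ?_
  refine h X A R hR _ fun B f hf => ?_
  rw [res_homSec, ← homSec_zero]
  congr 1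
  simpa using congr(Sigma.ι (fun p : (Σ B : 𝔞, R.arrows B) => u.obj p.1) ⟨B, f, hf⟩ ≫ $hg)

/-- A linear functor which induces a localization whose local objects are the sheaves for `T` is
generating and locally full, faithful, projective, finitely presented and ample. -/
theorem properties_of_inducesLocalization [IsGrothendieckAbelian.{v} 𝒞] (hT : T.IsTopology)
    (hl : InducesLocalization k u) (h : FactorsThroughEquivSh u T) :
    IsGenerating u ∧ IsTFull u T ∧ IsTFaithful u T ∧ IsTProjective u T ∧
      IsTFinitelyPresented u T ∧ IsTAmple u T := by
  obtain ⟨hfull, hfaithful, a, adj, ha, -⟩ := hl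
  refine ⟨isGenerating_of_faithful hfaithful,
    fun A => h.isEpi hT _ fun X => (bijective_repToHomMod_comp hfull A X).1,
    fun A => h.isMono hT adj _ fun X => bijective_repToHomMod_comp hfull A X,
    fun X Y c hc => h.isEpi hT _ fun Z φ ψ hφψ => ?_,
    fun J _ _ F c hc d hd =>
      ⟨h.isEpi hT _ fun X => (bijective_colimitComparison_comp hfull hfaithful hc hd X).1,
        h.isMono hT adj _ fun X => bijective_colimitComparison_comp hfull hfaithful hc hd X⟩,
    isTAmple_of_isSeparated fun X => (h.isSheaf X).isSeparated⟩
  obtain ⟨φ, rfl⟩ := (inducedFunctor k u).map_surjective φ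
  obtain ⟨ψ, rfl⟩ := (inducedFunctor k u).map_surjective ψ
  simp only [← Functor.map_comp] at hφψ
  congr 1
  exact (cancel_epi c).1 ((inducedFunctor k u).map_injective hφψ)

end Localization

end Functors

/-! ### Colimits of modules -/

section Colimits

variable {J : Type v} [SmallCategory J]

instance : ObjectProperty.IsClosedUnderColimitsOfShape
    (C := 𝔞ᵒᵖ ⥤ ModuleCat.{v} k) (fun M => IsLinearPresheaf k 𝔞 M) J where
  colimitsOfShape_le := by
    rintro M ⟨h⟩
    have nat {A B : 𝔞} (f : B ⟶ A) (j : J) : (h.ι.app j).app (op A) ≫ M.map f.op =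
        (h.diag.obj j).map f.op ≫ (h.ι.app j).app (op B) := ((h.ι.app j).naturality f.op).symm
    refine ⟨fun {A B} f g => ?_, fun {A B} r f => ?_⟩
    · refine (isColimitOfPreserves ((evaluation _ _).obj (op A)) h.isColimit).hom_ext fun j => ?_
      change (h.ι.app j).app (op A) ≫ _ = (h.ι.app j).app (op A) ≫ _
      rw [Preadditive.comp_add, nat, nat, nat, (h.prop_diag_obj j).map_add, Preadditive.add_comp]
    · refine (isColimitOfPreserves ((evaluation _ _).obj (op A)) h.isColimit).hom_ext fun j => ?_
      change (h.ι.app j).app (op A) ≫ _ = (h.ι.app j).app (op A) ≫ _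
      rw [Linear.comp_smul, nat, nat, (h.prop_diag_obj j).map_smul, Linear.smul_comp]

instance : HasColimitsOfShape J (RMod k 𝔞) :=
  hasColimitsOfShape_of_closedUnderColimits _ _

/-- The projection to the quotient by `U` vanishes on every colimit injection, hence is zero; no
description of the colimit is needed. -/
lemma SubMod.mem_of_isColimit {F : J ⥤ RMod k 𝔞} {d : Cocone F} (hd : IsColimit d)
    (U : SubMod d.pt)
    (h : ∀ (j : J) (A : 𝔞) (x : sec (F.obj j) A), ev (d.ι.app j) A x ∈ U.carrier A)
    {A : 𝔞} (y : sec d.pt A) : y ∈ U.carrier A := by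
  have : U.proj = 0 := hd.hom_ext fun j => hom_ext_ev fun A x =>
    (U.ev_proj_eq_zero_iff _).2 (h j A x)
  rw [← U.ev_proj_eq_zero_iff, this]
  rfl

end Colimits

/-! ### Direct sums of representable modules -/

section FreeMod

variable {ι : Type v} (A : ι → 𝔞) {M : RMod k 𝔞} {B : 𝔞}

variable (k) in
/-- The direct sum of the representable modules `𝔞(-, A j)`. -/
def freeMod : RMod k 𝔞 :=
  mkMod (fun B => Π₀ j, (B ⟶ A j))
    (fun g => DFinsupp.mapRange.linearMap fun j => Linear.leftComp k (A j) g)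
    (fun _ _ => DFinsupp.ext fun _ => Category.id_comp _)
    (fun _ _ _ => DFinsupp.ext fun _ => Category.assoc _ _ _)
    (fun _ _ _ => DFinsupp.ext fun _ => Preadditive.add_comp _ _ _ _ _ _)
    (fun _ _ _ => DFinsupp.ext fun _ => Linear.smul_comp _ _ _ _ _ _)

namespace freeMod

open Classical in
/-- The inclusion of a summand. -/
def incl (j : ι) : rep k (A j) ⟶ freeMod k A :=
  mkHom (fun B => DFinsupp.lsingle (M := fun j => (B ⟶ A j)) j) fun g _ =>
    (DFinsupp.mapRange_single (hf := fun j => map_zero (Linear.leftComp k (A j) g))).symm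

/-- The projection to a summand. -/
def proj (j : ι) : freeMod k A ⟶ rep k (A j) :=
  mkHom (fun B => DFinsupp.lapply (M := fun j => (B ⟶ A j)) j) fun _ _ => rfl

lemma incl_proj (j : ι) : incl A j ≫ proj A j = 𝟙 (rep k (A j)) := by
  classical
  refine hom_ext_ev fun B x => ?_
  exact DFinsupp.single_eq_same (β := fun j => (B ⟶ A j)) (i := j) (b := x)

lemma incl_proj_of_ne {j l : ι} (h : j ≠ l) : incl A j ≫ proj (k := k) A l = 0 := by
  classical
  refine hom_ext_ev fun B x => ?_
  exact DFinsupp.single_eq_of_ne (β := fun j => (B ⟶ A j)) (b := x) h.symm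

variable {A}

open Classical in
-- Serves as an induction principle: a section is the finite sum of its components.
lemma mem_of_forall_incl_proj (V : Submodule k (sec (freeMod k A) B)) (w : sec (freeMod k A) B)
    (h : ∀ j, ev (incl A j) B (ev (proj A j) B w) ∈ V) : w ∈ V := by
  have : w = DFinsupp.sum (β := fun j => (B ⟶ A j)) w
      fun j _ => ev (incl A j) B (ev (proj A j) B w) := DFinsupp.sum_single.symm
  rw [this]
  exact Submodule.sum_mem _ fun j _ => h j

lemma hom_ext {φ ψ : freeMod k A ⟶ M} (h : ∀ j, incl A j ≫ φ = incl A j ≫ ψ) : φ = ψ :=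
  hom_ext_ev fun B w => mem_of_forall_incl_proj (LinearMap.eqLocus (ev φ B) (ev ψ B)) w fun j =>
    congr(ev $(h j) B (ev (proj A j) B w))

open Classical in
/-- The components of the morphism from the direct sum induced by sections `x j ∈ M(A j)`. -/
def descApp (x : ∀ j, sec M (A j)) (B : 𝔞) : sec (freeMod k A) B →ₗ[k] sec M B :=
  DFinsupp.lsum (M := fun j => (B ⟶ A j)) ℕ fun j => orbit (x j) B

lemma descApp_incl (x : ∀ j, sec M (A j)) (j : ι) (y : sec (rep k (A j)) B) :
    descApp x B (ev (incl A j) B y) = ev (repHom (x j)) B y := by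
  classical
  exact DFinsupp.lsum_single (M := fun j => (B ⟶ A j)) ℕ (fun j => orbit (x j) B) j y

/-- The morphism from the direct sum induced by sections `x j ∈ M(A j)`. -/
def desc (x : ∀ j, sec M (A j)) : freeMod k A ⟶ M :=
  mkHom (fun B => descApp x B) fun {B D} g w => by
    refine mem_of_forall_incl_proj
      (LinearMap.eqLocus (descApp x D ∘ₗ res (freeMod k A) g) (res M g ∘ₗ descApp x B)) w
      fun j => ?_
    rw [LinearMap.mem_eqLocus, LinearMap.comp_apply, LinearMap.comp_apply, ← ev_res, descApp_incl,
      descApp_incl, ev_res]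

lemma incl_desc (x : ∀ j, sec M (A j)) (j : ι) : incl A j ≫ desc x = repHom (x j) :=
  hom_ext_ev fun _ y => descApp_incl x j y

/-- The tautological section of the direct sum. -/
def gen (j : ι) : sec (freeMod k A) (A j) := ev (incl A j) (A j) (repSec (𝟙 (A j)))

lemma ev_desc_gen (x : ∀ j, sec M (A j)) (j : ι) : ev (desc x) (A j) (gen j) = x j := by
  rw [gen, ← ev_comp, incl_desc, ev_repHom, res_id]

lemma hom_ext_gen {φ ψ : freeMod k A ⟶ M}
    (h : ∀ j, ev φ (A j) (gen j) = ev ψ (A j) (gen j)) : φ = ψ :=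
  hom_ext fun j => rep_hom_ext (h j)

end freeMod

end FreeMod

/-! ### Locally full, faithful, projective and finitely presented functors -/

section Functors

variable {𝒞 : Type u} [Category.{v} 𝒞] [Abelian 𝒞] [Linear k 𝒞]
variable {u : 𝔞 ⥤ 𝒞} [u.Additive] [u.Linear k] {T : CoveringSystem k 𝔞}

/-- A section of `i (colim F)` comes locally from the colimit of the modules `i (F j)`, and `W`
contains the image of that colimit once it contains the image of each `i (F j)`. -/
lemma IsTFinitelyPresented.mem_closure (h : IsTFinitelyPresented u T) (hT : T.IsTopology)
    {J : Type v} [SmallCategory J] [IsFiltered J] {F : J ⥤ 𝒞} {c : Cocone F} (hc : IsColimit c)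
    (W : SubMod ((inducedFunctor k u).obj c.pt))
    (hW : ∀ (j : J) (A : 𝔞) (f : u.obj A ⟶ F.obj j), homSec k u (f ≫ c.ι.app j) ∈ W.carrier A)
    {A : 𝔞} (f : u.obj A ⟶ c.pt) : homSec k u f ∈ (hT.closure W).carrier A := by
  have hd := colimit.isColimit (F ⋙ inducedFunctor k u)
  refine hT.closure_mono ?_ A ((hT.isEpi_iff _).1 (h J F c hc _ hd).1 A (homSec k u f))
  rintro B _ ⟨y, rfl⟩
  refine SubMod.mem_of_isColimit hd (W.comap (hd.desc ((inducedFunctor k u).mapCocone c))) ?_ y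
  intro j D x
  obtain ⟨x, rfl⟩ := homSec_surjective u x
  have := congr(ev $(hd.fac ((inducedFunctor k u).mapCocone c) j) D (homSec k u x))
  change ev (hd.desc ((inducedFunctor k u).mapCocone c)) D (ev _ D (homSec k u x)) ∈ W.carrier D
  rw [← ev_comp, this]
  exact hW j D x

variable [IsGrothendieckAbelian.{v} 𝒞]

lemma IsTAmple.isSeparated (h : IsTAmple u T) (X : 𝒞) :
    T.IsSeparated ((inducedFunctor k u).obj X) := by
  intro A R hR x hx
  obtain ⟨x, rfl⟩ := homSec_surjective u x
  have := h A R hR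
  rw [← homSec_zero]
  congr 1
  rw [← cancel_epi (Sigma.desc (f := fun p : (Σ B : 𝔞, R.arrows B) => u.obj p.1)
      fun p => u.map (p.2 : p.1 ⟶ A))]
  refine Sigma.hom_ext _ _ fun p => ?_
  rw [Sigma.ι_desc_assoc, comp_zero, comp_zero]
  exact homSec_injective (k := k) u (hx p.1 p.2.1 p.2.2)

/-! ### Free modules compared with coproducts in `𝒞`. -/

section Free

variable {ι : Type v} (A : ι → 𝔞)

variable (k u) in
/-- The canonical morphism `⨁ 𝔞(-, A j) ⟶ 𝒞(u(-), ⨁ u(A j))`. -/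
def freeToHomMod : freeMod k A ⟶ (inducedFunctor k u).obj (∐ fun j => u.obj (A j)) :=
  freeMod.desc fun j => homSec k u (Sigma.ι (fun j => u.obj (A j)) j)

lemma incl_freeToHomMod (j : ι) : freeMod.incl A j ≫ freeToHomMod k u A =
    repToHomMod k u (A j) ≫ (inducedFunctor k u).map (Sigma.ι (fun j => u.obj (A j)) j) := by
  rw [freeToHomMod, freeMod.incl_desc]
  exact hom_ext_ev fun _ _ => rfl

lemma ev_freeToHomMod_gen (j : ι) : ev (freeToHomMod k u A) (A j) (freeMod.gen j) =
    homSec k u (Sigma.ι (fun j => u.obj (A j)) j) := freeMod.ev_desc_gen _ j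

open Classical in
lemma freeToHomMod_proj (j : ι) :
    freeToHomMod k u A ≫ (inducedFunctor k u).map (Sigma.π (fun j => u.obj (A j)) j) =
      freeMod.proj A j ≫ repToHomMod k u (A j) := by
  refine freeMod.hom_ext fun l => ?_
  rw [← Category.assoc, incl_freeToHomMod, Category.assoc, ← Functor.map_comp, ← Category.assoc]
  by_cases h : l = j
  · subst h
    rw [Sigma.ι_π_eq_id, freeMod.incl_proj, Category.id_comp, CategoryTheory.Functor.map_id, Category.comp_id]
  · rw [Sigma.ι_π_of_ne _ h, freeMod.incl_proj_of_ne A h, zero_comp]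
    refine hom_ext_ev fun B x => ?_
    obtain ⟨x, rfl⟩ := repSec_surjective x
    rw [ev_comp, ev_repToHomMod, ev_map_homSec, comp_zero]
    rfl

/-- Each component of a section in the kernel is killed by `𝔞(-, A j) ⟶ i (u (A j))`, hence is
locally zero. -/
lemma isMono_freeToHomMod (hT : T.IsTopology) (h : IsTFaithful u T) :
    T.IsMono (freeToHomMod k u A) := by
  classical
  refine (hT.isMono_iff _).2 fun B w hw => freeMod.mem_of_forall_incl_proj _ w fun j => ?_
  refine hT.ev_mem_closure_zero _ ((hT.isMono_iff _).1 (h (A j)) B _ ?_)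
  rw [← ev_comp, ← freeToHomMod_proj, ev_comp, hw, map_zero]

/-- The coproduct is the filtered colimit of its finite subcoproducts. A section over one of those
is the finite sum of its components, which lift locally by `T`-fullness. -/
lemma isEpi_freeToHomMod (hT : T.IsTopology) (h : IsTFull u T) (h' : IsTFinitelyPresented u T) :
    T.IsEpi (freeToHomMod k u A) := by
  classical
  refine (hT.isEpi_iff _).2 fun B y => ?_
  obtain ⟨y, rfl⟩ := homSec_surjective u y
  rw [← hT.closure_closure]
  refine h'.mem_closure hT
    (CoproductsFromFiniteFiltered.isColimitFiniteSubproductsCocone fun j => u.obj (A j)) _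
    (fun S D f => ?_) y
  let G : S → 𝒞 := fun s => u.obj (A s.1.as)
  let q : ∐ G ⟶ ∐ fun j => u.obj (A j) :=
    Sigma.desc fun s => Sigma.ι (fun j => u.obj (A j)) s.1.as
  have hq : q = ∑ s, Sigma.π G s ≫ Sigma.ι (fun j => u.obj (A j)) s.1.as := by
    refine Sigma.hom_ext _ _ fun t => ?_
    rw [Preadditive.comp_sum, Finset.sum_eq_single t]
    · rw [Sigma.ι_desc, ← Category.assoc, Sigma.ι_π_eq_id, Category.id_comp]
    · intro s _ hs
      rw [← Category.assoc, Sigma.ι_π_of_ne _ hs.symm, zero_comp]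
    · exact fun ht => absurd (Finset.mem_univ t) ht
  suffices H : ∀ f : u.obj D ⟶ ∐ G, homSec k u (f ≫ q) ∈
      (hT.closure (SubMod.range (freeToHomMod k u A))).carrier D from H f
  clear f
  intro f
  have hsum : homSec k u (f ≫ q) = ∑ s, ev ((inducedFunctor k u).map
      (Sigma.ι (fun j => u.obj (A j)) s.1.as)) D (homSec k u (f ≫ Sigma.π G s)) := by
    rw [hq, Preadditive.comp_sum]
    refine (map_sum (AddMonoidHom.mk' (homSec k u) (homSec_add u)) _ _).trans ?_
    refine Finset.sum_congr rfl fun s _ => ?_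
    rw [ev_map_homSec, Category.assoc]
    rfl
  rw [hsum]
  refine Submodule.sum_mem _ fun s _ => ?_
  refine hT.ev_mem_closure _ ?_ ((hT.isEpi_iff _).1 (h (A s.1.as)) D _)
  rintro E _ ⟨x, rfl⟩
  refine ⟨ev (freeMod.incl A s.1.as) E x, ?_⟩
  rw [← ev_comp, incl_freeToHomMod, ev_comp]

end Free

lemma freeToHomMod_map_desc {ι : Type v} {A : ι → 𝔞} {X : 𝒞} (h : ∀ j, u.obj (A j) ⟶ X) :
    freeToHomMod k u A ≫ (inducedFunctor k u).map (Sigma.desc h) =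
      freeMod.desc fun j => homSec k u (h j) := by
  refine freeMod.hom_ext_gen fun j => ?_
  rw [ev_comp, ev_freeToHomMod_gen, ev_map_homSec, Sigma.ι_desc, freeMod.ev_desc_gen]

/-- Morphisms out of `X` can be constructed from a family of morphisms `h j : u(A j) ⟶ X` which is
jointly epimorphic, by specifying the composites with the `h j` in a way compatible with the linear
relations among the `h j`. -/
lemma exists_desc (hT : T.IsTopology) (hgen : IsGenerating u) (hfull : IsTFull u T)
    (hfp : IsTFinitelyPresented u T) (hample : IsTAmple u T) {ι : Type v} {A : ι → 𝔞} {X Y : 𝒞}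
    (h : ∀ j, u.obj (A j) ⟶ X) (hh : Epi (Sigma.desc h)) (ψ : ∀ j, u.obj (A j) ⟶ Y)
    (hψ : ∀ (D : 𝔞) (w : sec (freeMod k A) D), ev (freeMod.desc fun j => homSec k u (h j)) D w = 0 →
      ev (freeMod.desc fun j => homSec k u (ψ j)) D w = 0) :
    ∃ c : X ⟶ Y, ∀ j, h j ≫ c = ψ j := by
  -- Tested on generators `u(B)`: a morphism to the kernel lifts locally to sections `w` of the free
  -- module, to which `hψ` applies, and vanishing is local by ampleness.
  have hker : kernel.ι (Sigma.desc h) ≫ Sigma.desc ψ = 0 := by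
    refine hgen _ _ ?_
    rintro _ ⟨B⟩ g
    rw [comp_zero, ← Category.assoc]
    set y := g ≫ kernel.ι (Sigma.desc h) with hy
    have hy0 : y ≫ Sigma.desc h = 0 := by rw [hy, Category.assoc, kernel.condition, comp_zero]
    refine homSec_injective (k := k) u (hample.isSeparated Y B _
      ((hT.isEpi_iff _).1 (isEpi_freeToHomMod A hT hfull hfp) B (homSec k u y)) _ ?_)
    rintro D f ⟨w, hw⟩
    have hw : ev (freeToHomMod k u A) D w = homSec k u (u.map f ≫ y) := hw
    rw [res_homSec, ← Category.assoc, ← ev_map_homSec, ← hw, ← ev_comp, freeToHomMod_map_desc]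
    refine hψ D w ?_
    rw [← freeToHomMod_map_desc, ev_comp, hw, ev_map_homSec, Category.assoc, hy0, comp_zero,
      homSec_zero]
  refine ⟨Abelian.epiDesc (Sigma.desc h) (Sigma.desc ψ) hker, fun j => ?_⟩
  have := Sigma.ι (fun j => u.obj (A j)) j ≫= Abelian.comp_epiDesc (Sigma.desc h) (Sigma.desc ψ) hker
  rwa [Sigma.ι_desc_assoc, Sigma.ι_desc] at this

/-- By ampleness the `u(f)`, `f ∈ R`, are jointly epimorphic. By `T`-faithfulness, linear relations
among them already hold locally in `R`, so `φ` respects them, its target being separated. -/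
lemma isSheaf_inducedFunctor_obj (hT : T.IsTopology) (hgen : IsGenerating u)
    (hfull : IsTFull u T) (hfaithful : IsTFaithful u T) (hfp : IsTFinitelyPresented u T)
    (hample : IsTAmple u T) (X : 𝒞) : T.IsSheaf ((inducedFunctor k u).obj X) := by
  have hsep := hample.isSeparated X
  refine CoveringSystem.isSheaf_iff.2 ⟨hsep, fun A R hR φ => ?_⟩
  have hψ : ∀ p : (Σ B : 𝔞, R.arrows B), ∃ f : u.obj p.1 ⟶ X,
      homSec k u f = ev φ p.1 (R.mkSec p.2) := fun p => homSec_surjective u _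
  choose ψ hψ using hψ
  let ρ : freeMod k (fun p : (Σ B : 𝔞, R.arrows B) => p.1) ⟶ R.toMod :=
    freeMod.desc fun p => R.mkSec p.2
  have hρ : ρ ≫ R.incl ≫ repToHomMod k u A =
      freeMod.desc fun p : (Σ B : 𝔞, R.arrows B) => homSec k u (u.map (p.2 : p.1 ⟶ A)) := by
    refine freeMod.hom_ext_gen fun p => ?_
    rw [ev_comp, freeMod.ev_desc_gen, freeMod.ev_desc_gen, ev_comp, R.ev_incl, ev_repToHomMod]
  have hρ' : ρ ≫ φ = freeMod.desc fun p => homSec k u (ψ p) := by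
    refine freeMod.hom_ext_gen fun p => ?_
    rw [ev_comp, freeMod.ev_desc_gen, freeMod.ev_desc_gen, hψ]
  obtain ⟨c, hc⟩ := exists_desc hT hgen hfull hfp hample (A := fun p : (Σ B : 𝔞, R.arrows B) => p.1)
    (fun p => u.map (p.2 : p.1 ⟶ A)) (hample A R hR) ψ (fun D w hw => by
      rw [← hρ, ev_comp, ev_comp] at hw
      rw [← hρ', ev_comp]
      refine hT.isSeparated_iff.1 hsep D _ (hT.ev_mem_closure_zero φ ?_)
      have := (hT.mem_closure_comap R.incl _ _).2 ((hT.isMono_iff _).1 (hfaithful A) D _ hw)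
      have hle : (SubMod.zero (rep k A)).comap R.incl ≤ SubMod.zero R.toMod := fun B g hg =>
        (Submodule.mem_bot k).2 (Subtype.ext ((Submodule.mem_bot k).1 hg))
      exact hT.closure_mono hle D this)
  refine ⟨homSec k u c, fun B g => ?_⟩
  rw [res_homSec, hc ⟨B, g⟩, hψ]

/-- All morphisms `u(A) ⟶ X` together are epimorphic, and `φ`, being defined on `i X`, respects
every relation among them. -/
lemma full_inducedFunctor (hT : T.IsTopology) (hgen : IsGenerating u)
    (hfull : IsTFull u T) (hfp : IsTFinitelyPresented u T) (hample : IsTAmple u T) :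
    (inducedFunctor k u).Full where
  map_surjective {X Y} φ := by
    have hψ : ∀ p : (Σ A : 𝔞, (u.obj A ⟶ X)), ∃ f : u.obj p.1 ⟶ Y,
        homSec k u f = ev φ p.1 (homSec k u p.2) := fun p => homSec_surjective u _
    choose ψ hψ using hψ
    have hρ : (freeMod.desc fun p : (Σ A : 𝔞, (u.obj A ⟶ X)) => homSec k u p.2) ≫ φ =
        freeMod.desc fun p => homSec k u (ψ p) := by
      refine freeMod.hom_ext_gen fun p => ?_
      rw [ev_comp, freeMod.ev_desc_gen, freeMod.ev_desc_gen, hψ]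
    have hepi : Epi (Sigma.desc fun p : (Σ A : 𝔞, (u.obj A ⟶ X)) => p.2) := by
      refine ⟨fun f g hfg => hgen _ _ ?_⟩
      rintro _ ⟨A⟩ h
      simpa using congr(Sigma.ι (fun p : (Σ A : 𝔞, (u.obj A ⟶ X)) => u.obj p.1) ⟨A, h⟩ ≫ $hfg)
    obtain ⟨c, hc⟩ := exists_desc hT hgen hfull hfp hample
      (A := fun p : (Σ A : 𝔞, (u.obj A ⟶ X)) => p.1) (fun p => p.2) hepi ψ (fun D w hw => by
        rw [← hρ, ev_comp, hw, map_zero])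
    refine ⟨c, hom_ext_ev fun A x => ?_⟩
    obtain ⟨x, rfl⟩ := homSec_surjective u x
    rw [ev_map_homSec, hc ⟨A, x⟩, hψ]

end Functors

/-! ### The localization induced by a linear functor -/

/-- Morphisms descend along surjections. -/
lemma exists_desc_of_surjective {M N P : RMod k 𝔞} (f : M ⟶ N)
    (hf : ∀ A, Function.Surjective (ev f A)) (φ : M ⟶ P)
    (hφ : ∀ (A : 𝔞) (x : sec M A), ev f A x = 0 → ev φ A x = 0) : ∃ ψ : N ⟶ P, f ≫ ψ = φ := by
  have h : ∀ (A : 𝔞) (x x' : sec M A), ev f A x = ev f A x' → ev φ A x = ev φ A x' := by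
    intro A x x' hx
    rw [← sub_eq_zero, ← map_sub] at hx ⊢
    exact hφ A _ hx
  choose s hs using hf
  refine ⟨mkHom (fun A =>
    { toFun := fun y => ev φ A (s A y)
      map_add' := fun y y' => ?_
      map_smul' := fun r y => ?_ }) fun {A B} g y => ?_, hom_ext_ev fun A x => h A _ _ (hs A _)⟩
  · rw [← map_add]
    exact h A _ _ (by rw [hs, map_add, hs, hs])
  · rw [RingHom.id_apply, ← map_smul]
    exact h A _ _ (by rw [hs, map_smul, hs])
  · change ev φ B (s B _) = res P g (ev φ A (s A y))
    rw [← ev_res]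
    exact h B _ _ (by rw [hs, ev_res, hs])

section Functors

variable {𝒞 : Type u} [Category.{v} 𝒞] [Abelian 𝒞] [Linear k 𝒞]
variable {u : 𝔞 ⥤ 𝒞} [u.Additive] [u.Linear k] {T : CoveringSystem k 𝔞}

lemma IsTProjective.mem_closure (h : IsTProjective u T) (hT : T.IsTopology) {X Y : 𝒞}
    (c : X ⟶ Y) [Epi c] {M : RMod k 𝔞} {f : M ⟶ (inducedFunctor k u).obj X} (hf : T.IsEpi f)
    {A : 𝔞} (y : sec ((inducedFunctor k u).obj Y) A) :
    y ∈ (hT.closure (SubMod.range (f ≫ (inducedFunctor k u).map c))).carrier A := by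
  refine hT.closure_le_closure ?_ A ((hT.isEpi_iff _).1 (h c inferInstance) A y)
  rintro B _ ⟨x, rfl⟩
  refine hT.ev_mem_closure _ ?_ ((hT.isEpi_iff _).1 hf B x)
  rintro D _ ⟨z, rfl⟩
  exact ⟨z, rfl⟩

variable [IsGrothendieckAbelian.{v} 𝒞]

/-- Every module is locally isomorphic to a module of the form `𝒞(u(-), X)`. -/
lemma exists_isEpi_isMono (hT : T.IsTopology) (hfull : IsTFull u T) (hfaithful : IsTFaithful u T)
    (hproj : IsTProjective u T) (hfp : IsTFinitelyPresented u T) (M : RMod k 𝔞) :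
    ∃ (X : 𝒞) (η : M ⟶ (inducedFunctor k u).obj X), T.IsEpi η ∧ T.IsMono η := by
  let A : (Σ A : 𝔞, sec M A) → 𝔞 := fun p => p.1
  let ρ : freeMod k A ⟶ M := freeMod.desc fun p => p.2
  have hρgen (B : 𝔞) (x : sec M B) : ev ρ B (freeMod.gen (A := A) ⟨B, x⟩) = x :=
    freeMod.ev_desc_gen (A := A) (fun p => p.2) ⟨B, x⟩
  have hρ (B : 𝔞) : Function.Surjective (ev ρ B) := fun x => ⟨_, hρgen B x⟩
  -- Every section of the kernel is a generator, so each relation is literally the image under `κ`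
  -- of a generator.
  let A' : (Σ D : 𝔞, (SubMod.ker ρ).carrier D) → 𝔞 := fun r => r.1
  let κ : freeMod k A' ⟶ freeMod k A := freeMod.desc fun r => r.2.1
  have hκ : κ ≫ ρ = 0 := freeMod.hom_ext_gen fun r => by
    rw [ev_comp, freeMod.ev_desc_gen]
    exact r.2.2
  have hd : ∀ r, ∃ f : u.obj (A' r) ⟶ ∐ fun p => u.obj (A p),
    homSec k u f = ev (freeToHomMod k u A) (A' r) r.2.1 := fun r => homSec_surjective u _
  choose d hd using hd
  have hκd : freeToHomMod k u A' ≫ (inducedFunctor k u).map (Sigma.desc d) =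
      κ ≫ freeToHomMod k u A := by
    rw [freeToHomMod_map_desc]
    refine freeMod.hom_ext_gen fun r => ?_
    rw [ev_comp, freeMod.ev_desc_gen, freeMod.ev_desc_gen, hd]
  let π := cokernel.π (Sigma.desc d)
  obtain ⟨η, hη⟩ := exists_desc_of_surjective ρ hρ
    (freeToHomMod k u A ≫ (inducedFunctor k u).map π) (fun B w hw => by
      have hw' : ev κ B (freeMod.gen (A := A') ⟨B, w, hw⟩) = w :=
        freeMod.ev_desc_gen (A := A') (fun r => r.2.1) ⟨B, w, hw⟩
      rw [ev_comp, ← hw', ← ev_comp κ, ← hκd, ← ev_comp, Category.assoc, ← Functor.map_comp,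
        cokernel.condition, ev_comp]
      exact comp_zero)
  have hepi := isEpi_freeToHomMod (u := u) A hT hfull hfp
  have hepi' := isEpi_freeToHomMod (u := u) A' hT hfull hfp
  refine ⟨_, η, (hT.isEpi_iff _).2 fun B y => ?_, (hT.isMono_iff _).2 fun B x hx => ?_⟩
  · refine hT.closure_mono ?_ B (hproj.mem_closure hT π hepi y)
    rintro D _ ⟨w, rfl⟩
    exact ⟨ev ρ D w, by rw [← ev_comp, hη]⟩
  · obtain ⟨w, rfl⟩ := hρ B x
    rw [← ev_comp, hη, ev_comp] at hx
    obtain ⟨f, hf⟩ := homSec_surjective u (ev (freeToHomMod k u A) B w)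
    rw [← hf, ev_map_homSec] at hx
    have hfπ : f ≫ π = 0 := homSec_injective (k := k) u hx
    -- The kernel of `π` is the image of `Sigma.desc d`; projectivity is applied to the epimorphism
    -- onto this image.
    let l : u.obj B ⟶ Abelian.image (Sigma.desc d) := kernel.lift π f hfπ
    have hl : l ≫ Abelian.image.ι (Sigma.desc d) = f := kernel.lift_ι _ _ _
    have hmem : ev (freeToHomMod k u A) B w ∈
        (hT.closure (SubMod.range (κ ≫ freeToHomMod k u A))).carrier B := by
      rw [← hf, ← hl, ← ev_map_homSec]
      refine hT.ev_mem_closure _ ?_ (hproj.mem_closure hT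
        (Abelian.factorThruImage (Sigma.desc d)) hepi' (homSec k u l))
      rintro D _ ⟨z, rfl⟩
      refine ⟨z, ?_⟩
      rw [← ev_comp, Category.assoc, ← Functor.map_comp, Abelian.image.fac, hκd]
    -- On this covering, the restriction of `w` and some `κ z` have the same image in `i (∐ u (A
    -- p))`, so they differ by a locally zero section; since `κ ≫ ρ = 0`, the restriction of `ρ w`
    -- is locally zero.
    refine hT.mem_closure_of_local hmem _ ?_
    rintro D g ⟨z, hz⟩
    have hz : ev (freeToHomMod k u A) D (ev κ D z) =
      res _ g (ev (freeToHomMod k u A) B w) := hz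
    have h0 : ev (freeToHomMod k u A) D (res _ g w - ev κ D z) = 0 := by
      rw [map_sub, hz, ev_res, sub_self]
    have h1 := hT.ev_mem_closure_zero ρ ((hT.isMono_iff _).1
      (isMono_freeToHomMod (u := u) A hT hfaithful) D _ h0)
    have h2 : ev ρ D (ev κ D z) = 0 := by
      rw [← ev_comp, hκ]
      rfl
    rwa [map_sub, h2, sub_zero, ev_res] at h1

end Functors

/-! ### Exactness of the left adjoint -/

section Limits

variable {J : Type*} [Category* J] {F : J ⥤ RMod k 𝔞} {c : Cone F} (hc : IsLimit c)
include hc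

/-- Sections at `A` are morphisms from `𝔞(-, A)`, so the universal property determines the sections
of a limit. -/
lemma sec_ext_of_isLimit {A : 𝔞} {x : sec c.pt A}
    (h : ∀ j, ev (c.π.app j) A x = 0) : x = 0 := by
  have : repHom x = repHom 0 := hc.hom_ext fun j => rep_hom_ext <| by
    rw [ev_comp, ev_comp, ev_repHom, ev_repHom, res_id, res_id, h, map_zero]
  have h' := congr(ev $this A (repSec (𝟙 A)))
  rwa [ev_repHom, ev_repHom, res_id, res_id] at h'

lemma exists_sec_of_isLimit {A : 𝔞} (x : ∀ j, sec (F.obj j) A)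
    (h : ∀ {i j : J} (f : i ⟶ j), ev (F.map f) A (x i) = x j) :
    ∃ y : sec c.pt A, ∀ j, ev (c.π.app j) A y = x j := by
  let s : Cone F :=
    { pt := rep k A
      π :=
        { app := fun j => repHom (x j)
          naturality := fun i j f => rep_hom_ext <| by
            change ev (𝟙 _ ≫ repHom (x j)) A _ = ev (repHom (x i) ≫ F.map f) A _
            rw [Category.id_comp, ev_comp, ev_repHom, ev_repHom, res_id, res_id, h] } }
  refine ⟨ev (hc.lift s) A (repSec (𝟙 A)), fun j => ?_⟩
  rw [← ev_comp, hc.fac]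
  change ev (repHom (x j)) A _ = _
  rw [ev_repHom, res_id]

end Limits

section Functors

variable {𝒞 : Type u} [Category.{v} 𝒞] [Abelian 𝒞] [Linear k 𝒞]
variable {u : 𝔞 ⥤ 𝒞} [u.Additive] [u.Linear k] {T : CoveringSystem k 𝔞}

/-- A functor `a : Mod(𝔞) ⥤ 𝒞` preserves finite limits if the modules `M` are naturally locally
isomorphic to the sheaves `𝒞(u(-), a(M))`. -/
lemma preservesFiniteLimits_of_isEpi_isMono (hT : T.IsTopology)
    (hsheaf : ∀ X : 𝒞, T.IsSheaf ((inducedFunctor k u).obj X))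
    [(inducedFunctor k u).Full] [(inducedFunctor k u).Faithful] {a : RMod k 𝔞 ⥤ 𝒞}
    (η : ∀ M, M ⟶ (inducedFunctor k u).obj (a.obj M))
    (hη : ∀ {M N : RMod k 𝔞} (f : M ⟶ N), f ≫ η N = η M ≫ (inducedFunctor k u).map (a.map f))
    (hepi : ∀ M, T.IsEpi (η M)) (hmono : ∀ M, T.IsMono (η M)) : PreservesFiniteLimits a := by
  refine ⟨fun J _ _ => ⟨fun {F} => ⟨fun {c} hc => ⟨?_⟩⟩⟩⟩
  let γ : a.obj c.pt ⟶ limit (F ⋙ a) := limit.lift (F ⋙ a) (a.mapCone c)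
  let θ := η c.pt ≫ (inducedFunctor k u).map γ
  have hθ (j : J) : θ ≫ (inducedFunctor k u).map (limit.π (F ⋙ a) j) =
      c.π.app j ≫ η (F.obj j) := by
    rw [Category.assoc, ← Functor.map_comp, limit.lift_π]
    exact (hη (c.π.app j)).symm
  have hθ' (j : J) (A : 𝔞) (x : sec c.pt A) :
      ev ((inducedFunctor k u).map (limit.π (F ⋙ a) j)) A (ev θ A x) =
        ev (η (F.obj j)) A (ev (c.π.app j) A x) := by
    have := congr(ev $(hθ j) A x)
    rwa [ev_comp, ev_comp] at this
  have hlim (A : 𝔞) (y y' : sec ((inducedFunctor k u).obj (limit (F ⋙ a))) A)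
      (h : ∀ j, ev ((inducedFunctor k u).map (limit.π (F ⋙ a) j)) A y =
        ev ((inducedFunctor k u).map (limit.π (F ⋙ a) j)) A y') : y = y' := by
    obtain ⟨y, rfl⟩ := homSec_surjective u y
    obtain ⟨y', rfl⟩ := homSec_surjective u y'
    exact congrArg _ (limit.hom_ext fun j => homSec_injective (k := k) u (h j))
  have hθmono : T.IsMono θ := by
    refine (hT.isMono_iff _).2 fun A x hx => ?_
    have hx' (j : J) := (hT.isMono_iff _).1 (hmono (F.obj j)) A (ev (c.π.app j) A x)
      (by rw [← hθ', hx, map_zero])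
    -- Finiteness of `J` gives one covering on which all components vanish.
    obtain ⟨S, hS, h⟩ := hT.iInf_mem _ hx'
    refine hT.mem_of_le hS fun B g hg => (Submodule.mem_bot k).2 ?_
    refine sec_ext_of_isLimit hc fun j => ?_
    rw [← (Submodule.mem_bot k).1 ((h B g).1 hg j)]
    exact ev_res _ g x
  have hθepi : T.IsEpi θ := by
    refine (hT.isEpi_iff _).2 fun A z => ?_
    let p (j : J) : sec ((inducedFunctor k u).obj (a.obj (F.obj j))) A :=
      ev ((inducedFunctor k u).map (limit.π (F ⋙ a) j)) A z
    obtain ⟨S, hS, h⟩ := hT.iInf_mem _ fun j => (hT.isEpi_iff _).1 (hepi (F.obj j)) A (p j)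
    refine hT.mem_closure_of_local hS z fun B g hg => ?_
    choose x hx using (h B g).1 hg
    have hx (j : J) : ev (η (F.obj j)) B (x j) = res _ g (p j) := hx j
    -- The local lifts `x j` are compatible only up to locally zero sections. As `J` has finitely
    -- many arrows, one further covering makes them strictly compatible, hence a section of the
    -- limit.
    have hcompat (t : Σ i j : J, i ⟶ j) : ev (F.map t.2.2) B (x t.1) - x t.2.1 ∈
        (hT.closure (SubMod.zero (F.obj t.2.1))).carrier B := by
      obtain ⟨i, j, f⟩ := t
      refine (hT.isMono_iff _).1 (hmono (F.obj j)) B _ ?_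
      have hnat : ev (η (F.obj j)) B (ev (F.map f) B (x i)) =
          ev ((inducedFunctor k u).map (a.map (F.map f))) B (ev (η (F.obj i)) B (x i)) :=
        congr(ev $(hη (F.map f)) B (x i))
      have hp : ev ((inducedFunctor k u).map (a.map (F.map f))) A (p i) = p j := by
        have hw : limit.π (F ⋙ a) i ≫ a.map (F.map f) = limit.π (F ⋙ a) j := limit.w (F ⋙ a) f
        have := congr(ev ((inducedFunctor k u).map $hw) A z)
        rwa [Functor.map_comp, ev_comp] at this
      rw [map_sub, hnat, hx, hx]
      exact sub_eq_zero.2 ((ev_res _ g _).trans congr(res _ g $hp))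
    obtain ⟨S', hS', h'⟩ := hT.iInf_mem _ hcompat
    refine hT.mem_of_le hS' fun D e he => ?_
    obtain ⟨y, hy⟩ := exists_sec_of_isLimit hc (fun j => res (F.obj j) e (x j)) (fun {i j} f => by
      have := (Submodule.mem_bot k).1 ((h' D e).1 he ⟨i, j, f⟩)
      rw [ev_res, ← sub_eq_zero, ← map_sub]
      exact this)
    refine ⟨y, hlim D _ _ fun j => ?_⟩
    rw [hθ', hy, ev_res, hx]
    exact ((ev_res _ e (res _ g z)).trans congr(res _ e $(ev_res _ g z))).symm
  -- `θ` is `η` followed by `i γ`, and both `θ` and `η` are `T`-isomorphisms, so `i γ` is one too,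
  -- between sheaves.
  have : IsIso ((inducedFunctor k u).map γ) := by
    refine hT.isIso_of_isSheaf ?_ ?_ (hsheaf _) (hsheaf _)
    · refine (hT.isEpi_iff _).2 fun A y => ?_
      refine hT.closure_mono ?_ A ((hT.isEpi_iff _).1 hθepi A y)
      rintro B _ ⟨x, rfl⟩
      exact ⟨_, rfl⟩
    · refine (hT.isMono_iff _).2 fun A y hy => ?_
      refine hT.mem_closure_of_local ((hT.isEpi_iff _).1 (hepi c.pt) A y) y ?_
      rintro B g ⟨x, hx⟩
      have hx : ev (η c.pt) B x = res _ g y := hx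
      rw [← hx]
      refine hT.ev_mem_closure_zero _ ((hT.isMono_iff _).1 hθmono B x ?_)
      rw [ev_comp, hx]
      exact (ev_res _ g y).trans (by rw [hy, map_zero])
  have : IsIso ((limit.isLimit (F ⋙ a)).lift (a.mapCone c)) :=
    isIso_of_reflects_iso γ (inducedFunctor k u)
  exact IsLimit.ofPointIso (limit.isLimit (F ⋙ a))

variable [IsGrothendieckAbelian.{v} 𝒞]

/-- A linear functor which is generating and locally full, faithful, projective, finitely presented
and ample induces a localization whose local objects are the sheaves for `T`. -/
theorem inducesLocalization_of_properties (hT : T.IsTopology) (hgen : IsGenerating u)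
    (hfull : IsTFull u T) (hfaithful : IsTFaithful u T) (hproj : IsTProjective u T)
    (hfp : IsTFinitelyPresented u T) (hample : IsTAmple u T) :
    InducesLocalization k u ∧ FactorsThroughEquivSh u T := by
  have hsheaf := isSheaf_inducedFunctor_obj hT hgen hfull hfaithful hfp hample
  have := full_inducedFunctor hT hgen hfull hfp hample
  have := faithful_inducedFunctor (k := k) hgen
  choose X η hepi hmono using exists_isEpi_isMono (u := u) hT hfull hfaithful hproj hfp
  constructor
  · let e (M : RMod k 𝔞) (Y : 𝒞) : (X M ⟶ Y) ≃ (M ⟶ (inducedFunctor k u).obj Y) :=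
      Equiv.ofBijective (fun c => η M ≫ (inducedFunctor k u).map c) <| by
        refine ⟨fun c c' h => (inducedFunctor k u).map_injective
          (CoveringSystem.hom_ext_of_isEpi (hepi M) (hsheaf Y).isSeparated h), fun φ => ?_⟩
        obtain ⟨ψ, hψ⟩ := hT.exists_extension (hepi M) (hmono M) (hsheaf Y) φ
        exact ⟨(inducedFunctor k u).preimage ψ, by simpa using hψ⟩
    have he : ∀ M Y Y' (g : Y ⟶ Y') (h : X M ⟶ Y),
        e M Y' (h ≫ g) = e M Y h ≫ (inducedFunctor k u).map g := fun M Y Y' g h => by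
      change η M ≫ (inducedFunctor k u).map (h ≫ g) =
        (η M ≫ (inducedFunctor k u).map h) ≫ (inducedFunctor k u).map g
      rw [Functor.map_comp, Category.assoc]
    let adj := Adjunction.adjunctionOfEquivLeft e he
    have hunit (M : RMod k 𝔞) : adj.unit.app M = η M := by
      simp [adj, e, Adjunction.adjunctionOfEquivLeft]
    refine ⟨inferInstance, inferInstance, _, adj,
      preservesFiniteLimits_of_isEpi_isMono hT hsheaf (fun M => adj.unit.app M)
        (fun f => adj.unit.naturality f) (fun M => ?_) (fun M => ?_),
      have := adj.leftAdjoint_preservesColimits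
      inferInstance⟩
    · rw [hunit]
      exact hepi M
    · rw [hunit]
      exact hmono M
  · let G : 𝒞 ⥤ T.Sh := ObjectProperty.lift _ (inducedFunctor k u) hsheaf
    -- On a sheaf, `η` is a `T`-isomorphism between sheaves, hence invertible.
    have : G.EssSurj := ⟨fun F => ⟨X F.obj, by
      have := hT.isIso_of_isSheaf (hepi F.obj) (hmono F.obj) F.property (hsheaf _)
      exact ⟨(ObjectProperty.fullyFaithfulι _).preimageIso (asIso (η F.obj)).symm⟩⟩⟩
    have : G.IsEquivalence := { }
    exact ⟨G.asEquivalence, ⟨Iso.refl _⟩⟩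

end Functors

end LinTop

end

theorem theorem2 {k : Type w} [CommRing k]
    {𝔞 : Type v} [SmallCategory 𝔞] [Preadditive 𝔞] [Linear k 𝔞]
    {𝒞 : Type u} [Category.{v} 𝒞] [Abelian 𝒞] [Linear k 𝒞] [IsGrothendieckAbelian.{v} 𝒞]
    (u : 𝔞 ⥤ 𝒞) [u.Additive] [u.Linear k]
    (T : LinTop.CoveringSystem k 𝔞) (hT : T.IsTopology) :
    (LinTop.InducesLocalization k u ∧ LinTop.FactorsThroughEquivSh u T) ↔
      (LinTop.IsGenerating u ∧ LinTop.IsTFull u T ∧ LinTop.IsTFaithful u T ∧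
        LinTop.IsTProjective u T ∧ LinTop.IsTFinitelyPresented u T ∧ LinTop.IsTAmple u T) :=
  ⟨fun h => LinTop.properties_of_inducesLocalization hT h.1 h.2,
    fun ⟨h₁, h₂, h₃, h₄, h₅, h₆⟩ =>
      LinTop.inducesLocalization_of_properties hT h₁ h₂ h₃ h₄ h₅ h₆⟩
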